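/- Let $p$ be a prime, let $G=\mathbb Z/p$ be the cyclic group of order $p$, and let $P$ and $Q$ be nonempty finite free $G$-posets, i.e. nonempty finite partially ordered sets with an order-preserving action of $G$ such that $g\cdot x=x$ only for $g=e$. For an integer $r\ge 2$, let $\mathcal C_P^{(r)}$ be the $r$-uniform hypergraph with vertex set $P$ in which a set $A\subseteq P$ of $r$ distinct elements is an edge if and only if for any two distinct $a,b\in A$ there is $g\in G\setminus\{e\}$ such that $a$ and $g\cdot b$ are comparable in $P$; define $\mathcal C_Q^{(r)}$ likewise. The categorical product $\mathcal H_1\times\mathcal H_2$ of two hypergraphs has vertex set $V(\mathcal H_1)\times V(\mathcal H_2)$, and its edges are the sets $\{(u_1,v_1),\dots,(u_s,v_s)\}$, $s\ge 1$, with $\{u_1,\dots,u_s\}\in E(\mathcal H_1)$ and $\{v_1,\dots,v_s\}\in E(\mathcal H_2)$. The chromatic number $\chi(\mathcal H)$ is the least $m$ for which the vertices can be colored with $m$ colors so that no edge is monochromatic. Let $\|\Delta(P)\|$ be the geometric realization of the order complex of $P$ (whose simplices are the nonempty chains of $P$), with the induced $G$-action. For a $G$-space $X$, let $\operatorname{coind}X$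 be the maximal $k\ge 0$ such that there is a continuous $G$-equivariant map $E_kG\to X$, where $E_kG=G*G*\cdots*G$ is the join of $k+1$ copies of the discrete space $G$ with the diagonal action of $G$ by left translations. Then the maxima defining $\operatorname{coind}\|\Delta(P)\|$ and $\operatorname{coind}\|\Delta(Q)\|$ exist, and for every integer $r$ with $2\le r\le p$, $$\left\lceil\frac{\min\{\operatorname{coind}\|\Delta(P)\|,\operatorname{coind}\|\Delta(Q)\|\}+1}{r-1}\right\rceil+\left\lceil\frac{p}{r-1}\right\rceil-1\;\le\;\chi\left(\mathcal C_P^{(r)}\times\mathcal C_Q^{(r)}\right).$$ -/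

import Mathlib

/-! ### Group actions on simplicial complexes and their polyhedra -/

/-- A `G`-poset: a partially ordered set with an order-preserving action of the group `G`. -/
class GPoset (G : Type*) (P : Type*) [Group G] [PartialOrder P] extends MulAction G P where
  smul_le_smul_of_le : ∀ (g : G) {a b : P}, a ≤ b → g • a ≤ g • b

/-- The action of `G` on `P` is free: only the identity has a fixed point. -/
def IsFreeAction (G : Type*) (P : Type*) [Group G] [MulAction G P] : Prop :=
  ∀ (g : G) (x : P), g • x = x → g = 1

/-- The group `G`, acting on the vertices of `K`, acts on `K` by simplicial maps. -/
class IsSimplicialAction (G : Type*) {V : Type*} [Group G] [MulAction G V]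
    (K : AbstractSimplicialComplex V) : Prop where
  map_mem : ∀ (g : G), ∀ s ∈ K.faces, s.map (MulAction.toPerm g).toEmbedding ∈ K.faces

/-- The underlying set of the polyhedron (geometric realization) of `K`, in barycentric
coordinates: convex combinations of vertices supported on a face of `K`. -/
def Realization {V : Type*} (K : AbstractSimplicialComplex V) : Type _ :=
  {x : V → ℝ // (∀ v, 0 ≤ x v) ∧ ∃ s ∈ K.faces, (∀ v, v ∉ s → x v = 0) ∧ ∑ v ∈ s, x v = 1}

/-- The polyhedron of a finite complex is topologized as a subspace of `ℝ^V`. (For infinitely many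
vertices this would not be the usual topology, so the instance is restricted to finite `V`.) -/
instance Realization.instTopologicalSpace {V : Type*} [Finite V]
    (K : AbstractSimplicialComplex V) : TopologicalSpace (Realization K) :=
  inferInstanceAs (TopologicalSpace {x : V → ℝ //
    (∀ v, 0 ≤ x v) ∧ ∃ s ∈ K.faces, (∀ v, v ∉ s → x v = 0) ∧ ∑ v ∈ s, x v = 1})

/-- The induced action on the polyhedron, extending the action on vertices affinely to each face:
the coordinate of `g • x` at `g • v` is the coordinate of `x` at `v`. -/
instance Realization.instMulAction {G V : Type*} [Group G] [MulAction G V]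
    (K : AbstractSimplicialComplex V) [IsSimplicialAction G K] : MulAction G (Realization K) where
  smul g x := ⟨fun v => x.1 (g⁻¹ • v), fun v => x.2.1 _, by
    obtain ⟨s, hs, h0, h1⟩ := x.2.2
    refine ⟨s.map (MulAction.toPerm g).toEmbedding, IsSimplicialAction.map_mem g s hs, ?_, ?_⟩
    · intro v hv
      apply h0
      intro hmem
      exact hv (Finset.mem_map.2 ⟨g⁻¹ • v, hmem, by simp⟩)
    · rw [Finset.sum_map]
      simpa using h1⟩
  one_smul x := Subtype.ext (funext fun v => by
    change x.1 ((1 : G)⁻¹ • v) = x.1 v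
    simp)
  mul_smul g h x := Subtype.ext (funext fun v => by
    change x.1 ((g * h)⁻¹ • v) = x.1 (h⁻¹ • g⁻¹ • v)
    rw [mul_inv_rev, mul_smul])

/-! ### The order complex -/

/-- The order complex `Δ(P)`: vertices are the elements of `P`, simplices are the nonempty finite
chains of `P`. -/
def orderComplex (P : Type*) [PartialOrder P] : AbstractSimplicialComplex P where
  faces := {s | s.Nonempty ∧ IsChain (· ≤ ·) (s : Set P)}
  isRelLowerSet_faces := fun _ hs => ⟨hs.1, fun _ hts ht =>
    ⟨ht, hs.2.mono (Finset.coe_subset.2 hts)⟩⟩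
  singleton_mem v := ⟨Finset.singleton_nonempty v, by simp⟩

instance orderComplex.instIsSimplicialAction (G P : Type*) [Group G] [PartialOrder P]
    [GPoset G P] : IsSimplicialAction G (orderComplex P) where
  map_mem g s hs := by
    refine ⟨hs.1.map, ?_⟩
    intro a ha b hb hab
    obtain ⟨a, ha', rfl⟩ := Finset.mem_map.1 (Finset.mem_coe.1 ha)
    obtain ⟨b, hb', rfl⟩ := Finset.mem_map.1 (Finset.mem_coe.1 hb)
    exact (hs.2.total ha' hb').imp (GPoset.smul_le_smul_of_le g) (GPoset.smul_le_smul_of_le g)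

/-! ### The spaces `E_k G` and the mapping co-index -/

/-- The `(k+1)`-fold simplicial join `G * G * ⋯ * G` of the discrete set `G`: vertices are the
disjoint union of `k + 1` copies of `G`, simplices are the nonempty finite sets of vertices that
contain at most one vertex of each copy. The action of `G` on its vertices is by left
multiplication in each copy. -/
def joinComplex (G : Type*) (k : ℕ) : AbstractSimplicialComplex (Σ _ : Fin (k + 1), G) where
  faces := {s | s.Nonempty ∧ ∀ a ∈ s, ∀ b ∈ s, a.1 = b.1 → a = b}
  isRelLowerSet_faces := fun _ hs => ⟨hs.1, fun _ hts ht =>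
    ⟨ht, fun a ha b hb => hs.2 a (hts ha) b (hts hb)⟩⟩
  singleton_mem v := ⟨Finset.singleton_nonempty v, by
    intro a ha b hb _
    rw [Finset.mem_singleton.1 ha, Finset.mem_singleton.1 hb]⟩

instance joinComplex.instIsSimplicialAction (G : Type*) [Group G] (k : ℕ) :
    IsSimplicialAction G (joinComplex G k) where
  map_mem g s hs := by
    refine ⟨hs.1.map, ?_⟩
    intro a ha b hb hab
    obtain ⟨a, ha', rfl⟩ := Finset.mem_map.1 ha
    obtain ⟨b, hb', rfl⟩ := Finset.mem_map.1 hb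
    rw [hs.2 a ha' b hb' hab]

/-- The `G`-space `E_k G = G * G * ⋯ * G` (`k + 1` factors). -/
abbrev EG (G : Type*) (k : ℕ) : Type _ := Realization (joinComplex G k)

/-- The set of all `k` such that there is a continuous `G`-equivariant map `E_k G → X`. -/
def coindSet (G : Type*) (X : Type*) [Group G] [Finite G] [TopologicalSpace X]
    [MulAction G X] : Set ℕ :=
  {k | ∃ f : EG G k → X, Continuous f ∧ ∀ (g : G) (x : EG G k), f (g • x) = g • f x}

/-- The mapping co-index of `X`: the maximal `k` such that there is a continuous `G`-equivariant
map `E_k G → X`. (It is meaningful when this maximum exists, i.e. when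
`IsGreatest (coindSet G X) (coind G X)`.) -/
noncomputable def coind (G : Type*) (X : Type*) [Group G] [Finite G] [TopologicalSpace X]
    [MulAction G X] : ℕ :=
  sSup (coindSet G X)

/-! ### Hypergraphs -/

namespace Hypergraph

/-- `H` has a proper `m`-coloring: no edge is monochromatic, i.e. every edge contains two vertices
of different colors. -/
def ProperlyColorable {α : Type*} (H : Hypergraph α) (m : ℕ) : Prop :=
  ∃ c : H.vertexSet → Fin m, ∀ e ∈ H.edgeSet,
    ∃ x y : H.vertexSet, (x : α) ∈ e ∧ (y : α) ∈ e ∧ c x ≠ c y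

/-- The chromatic number: the least `m` such that `H` is `m`-colorable (`⊤` if there is none). -/
noncomputable def chromaticNumber {α : Type*} (H : Hypergraph α) : ℕ∞ :=
  ⨅ m ∈ {m : ℕ | H.ProperlyColorable m}, (m : ℕ∞)

/-- The categorical product: its edges are the nonempty finite sets
`{(u₁, v₁), …, (uₛ, vₛ)}` with `{u₁, …, uₛ}` an edge of `H₁` and `{v₁, …, vₛ}` an edge of `H₂`. -/
def categoricalProduct {α β : Type*} (H₁ : Hypergraph α) (H₂ : Hypergraph β) :
    Hypergraph (α × β) where
  vertexSet := H₁.vertexSet ×ˢ H₂.vertexSet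
  edgeSet := {A | A.Nonempty ∧ A.Finite ∧
    Prod.fst '' A ∈ H₁.edgeSet ∧ Prod.snd '' A ∈ H₂.edgeSet}
  subset_vertexSet_of_mem_edgeSet' := fun _ hA x hx =>
    ⟨H₁.subset_vertexSet_of_mem_edgeSet' hA.2.2.1 ⟨x, hx, rfl⟩,
      H₂.subset_vertexSet_of_mem_edgeSet' hA.2.2.2 ⟨x, hx, rfl⟩⟩

end Hypergraph

/-- The compatibility `r`-uniform hypergraph `C_P^{(r)}` of a `G`-poset `P`: its vertices are the
elements of `P`; a set `e` of `r` elements is an edge when for any distinct `a, b ∈ e` there is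
`g ≠ 1` in `G` such that `a` and `g • b` are comparable. -/
def compatibilityHypergraph (G : Type*) (P : Type*) [Group G] [PartialOrder P] [GPoset G P]
    (r : ℕ) : Hypergraph P where
  vertexSet := Set.univ
  edgeSet := {e | e.Finite ∧ e.ncard = r ∧
    ∀ a ∈ e, ∀ b ∈ e, a ≠ b → ∃ g : G, g ≠ 1 ∧ (a ≤ g • b ∨ g • b ≤ a)}
  subset_vertexSet_of_mem_edgeSet' := fun _ _ => Set.subset_univ _

/-! Let `c` be a proper colouring of the product with `m` colours, and let `k` be at most both
co-indices. Equivariant maps out of `E_k G` send a sufficiently fine list of points to points of the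
two polyhedra whose large coordinates sit on chains `s` in `P` and `t` in `Q`. For each colour `i`
let `d i` be the set of `g` such that `c` takes the value `i` on `g⁻¹(s × t)`. If `d i` had `r`
elements, translating members of `s` and `t` back by them would give a monochromatic edge; so `|d i|
≤ r - 1`. Every `g` sees some colour, so `∑ |d i| ≥ p`. Since `r ≤ p` and `p` is prime, `G` acts
freely on such families. The assignment is equivariant and monotone, so a Dold-type theorem
(`exists_strict_chain_of_labelling`) yields `k + 1` strictly nested families. Their total sizes lie
between `p` and `m(r - 1)`, whence `k + p ≤ m(r - 1)` (`add_card_le_of_colouring`). Using the chains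
of one poset as labels bounds its co-index in the same way.

The Dold-type theorem is algebra with ordered chains over the field with `p` elements. Iterated
cones give chains `h n` in `E_k G` with `∂ h 0 = []` and `∂ h (n+1) = τ n (h n)`, where `τ n` is
alternately `γ - 1` and the norm. Subdivision preserves these relations, makes the lists fine, and
finally replaces points by labels. Discarding lists with repetitions leaves strict chains of labels.
If there were none of length `k + 1`, exactness of the `τ n` on free modules would allow a descent
from degree `k` to degree `0`, ending in `1 = |G| · a = 0` (`exists_strict_chain_of_isPeriodicSeq`).
-/

namespace ListChain

open Finsupp

/-- Ordered chains with coefficients in `F`: formal combinations of lists of vertices. The empty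
list spans the augmentation degree. -/
abbrev Chain (F X : Type*) [Zero F] := List X →₀ F

theorem map_mem_of_single_mem {F α M : Type*} [CommRing F] [AddCommGroup M] [Module F M]
    (f : (α →₀ F) →ₗ[F] M) (N : Submodule F M) {s : Set α}
    (h : ∀ a ∈ s, f (single a 1) ∈ N) {c : α →₀ F} (hc : c ∈ supported F F s) : f c ∈ N := by
  rw [supported_eq_span_single] at hc
  have : Submodule.span F ((fun i => single i (1 : F)) '' s) ≤ N.comap f := by
    rw [Submodule.span_le]
    rintro _ ⟨a, ha, rfl⟩
    exact h a ha
  exact this hc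

theorem eq_of_eq_on_single {F α M : Type*} [CommRing F] [AddCommGroup M] [Module F M]
    (f g : (α →₀ F) →ₗ[F] M) {s : Set α}
    (h : ∀ a ∈ s, f (single a 1) = g (single a 1)) {c : α →₀ F} (hc : c ∈ supported F F s) :
    f c = g c := by
  have := map_mem_of_single_mem (f - g) ⊥ (s := s) (by
    intro a ha
    simp [h a ha]) hc
  simpa [sub_eq_zero] using this

theorem lhom_ext_one {F α M : Type*} [CommRing F] [AddCommGroup M] [Module F M]
    {f g : (α →₀ F) →ₗ[F] M} (h : ∀ a, f (single a 1) = g (single a 1)) : f = g := by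
  ext a
  simpa using h a

/-! ### Ordered chains: boundary, subdivision, normalization -/

section Boundary

variable {F X Y : Type*} [CommRing F]

/-- Adding a vertex in front of every list. -/
noncomputable def cone (x : X) : Chain F X →ₗ[F] Chain F X := lmapDomain F F (List.cons x)

@[simp] theorem cone_single (x : X) (l : List X) (a : F) :
    cone x (single l a) = single (x :: l) a := by
  simp [cone]

/-- The boundary of a list, that is, the alternating sum of its facets. -/
noncomputable def bdList (F : Type*) [CommRing F] : List X → Chain F X
  | [] => 0
  | x :: l => single l 1 - cone x (bdList F l)

/-- The boundary operator. -/
noncomputable def bd : Chain F X →ₗ[F] Chain F X := linearCombination F (bdList F)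

theorem bd_single (l : List X) : bd (single l (1 : F)) = bdList F l := by
  simp [bd]

@[simp] theorem bd_nil (a : F) : bd (single ([] : List X) a) = 0 := by
  simp [bd, bdList]

theorem bd_cone (x : X) (c : Chain F X) : bd (cone x c) = c - cone x (bd c) := by
  have : bd ∘ₗ cone x = LinearMap.id - cone x ∘ₗ (bd : Chain F X →ₗ[F] _) := by
    refine lhom_ext_one fun l => ?_
    simp [bd_single, bdList]
  exact LinearMap.congr_fun this c

theorem bd_bd (c : Chain F X) : bd (bd c) = 0 := by
  have : bd ∘ₗ (bd : Chain F X →ₗ[F] _) = 0 := by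
    refine lhom_ext_one fun l => ?_
    induction l with
    | nil => simp
    | cons x l ih =>
      have e : single (x :: l) (1 : F) = cone x (single l 1) := by simp
      simp only [LinearMap.comp_apply, LinearMap.zero_apply] at ih ⊢
      rw [e, bd_cone, map_sub, bd_cone, ih]
      simp
  exact LinearMap.congr_fun this c

theorem bd_single_mem (l : List X) :
    bd (single l (1 : F)) ∈ supported F F {m : List X | m.Sublist l ∧ m.length + 1 = l.length} := by
  induction l with
  | nil => simp
  | cons x l ih =>
    have e : single (x :: l) (1 : F) = cone x (single l 1) := by simp
    rw [e, bd_cone]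
    refine sub_mem (single_mem_supported _ _ ⟨by simp, by simp⟩) ?_
    refine map_mem_of_single_mem _ _ ?_ ih
    rintro m ⟨hm, hl⟩
    rw [cone_single]
    exact single_mem_supported _ _ ⟨hm.cons_cons x, by simp [hl]⟩

/-- The subdivision operator in degree `n` attached to a choice `b` of a barycentre for every list:
a list is sent to the cone, with apex its barycentre, over the subdivision of its boundary. -/
noncomputable def subdiv (b : List X → Y) : ℕ → Chain F X →ₗ[F] Chain F Y
  | 0 => lsingle [] ∘ₗ lapply []
  | n + 1 => linearCombination F fun l => cone (b l) (subdiv b n (bd (single l 1)))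

theorem subdiv_succ_single (b : List X → Y) (n : ℕ) (l : List X) :
    subdiv b (n + 1) (single l (1 : F)) = cone (b l) (subdiv b n (bd (single l 1))) := by
  simp [subdiv]

/-- The cone formula reduces this to the vanishing of the boundary of the subdivided boundary, which
is the previous degree together with `bd_bd`. -/
theorem bd_subdiv (b : List X → Y) (n : ℕ) (c : Chain F X) :
    bd (subdiv b (n + 1) c) = subdiv b n (bd c) := by
  have : bd ∘ₗ subdiv b (n + 1) = subdiv b n ∘ₗ (bd : Chain F X →ₗ[F] _) := by
    induction n with
    | zero =>
      refine lhom_ext_one fun l => ?_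
      simp only [LinearMap.comp_apply, subdiv_succ_single, bd_cone]
      simp [subdiv]
    | succ n ih =>
      refine lhom_ext_one fun l => ?_
      have := LinearMap.congr_fun ih (bd (single l 1))
      simp only [LinearMap.comp_apply] at this
      simp only [LinearMap.comp_apply, subdiv_succ_single _ (n + 1), bd_cone]
      rw [this, bd_bd]
      simp
  exact LinearMap.congr_fun this c

/-- The lists occurring in the subdivision of `l`: decreasing lists of barycentres of nonempty
sublists of `l`. -/
def subdivLists (b : List X → Y) (l : List X) : Set (List Y) :=
  {L | L.length = l.length ∧ ∃ S : List (List X), L = S.map b ∧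
    S.Pairwise (fun m m' => m'.Sublist m) ∧ ∀ m ∈ S, m.Sublist l ∧ m ≠ []}

theorem subdiv_single_mem (b : List X → Y) (n : ℕ) (l : List X) (hl : l.length = n) :
    subdiv b n (single l (1 : F)) ∈ supported F F (subdivLists b l) := by
  induction n generalizing l with
  | zero =>
    obtain rfl := List.length_eq_zero_iff.1 hl
    simp only [subdiv, LinearMap.comp_apply, lapply_apply, lsingle_apply, single_eq_same]
    exact single_mem_supported F _ (s := subdivLists b []) ⟨rfl, [], by simp⟩
  | succ n ih =>
    rw [subdiv_succ_single]
    have h1 : subdiv b n (bd (single l (1 : F))) ∈ supported F F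
        {L | ∃ m : List X, m.Sublist l ∧ m.length + 1 = l.length ∧ L ∈ subdivLists b m} := by
      refine map_mem_of_single_mem _ _ ?_ (bd_single_mem l)
      rintro m ⟨hm, hml⟩
      refine supported_mono ?_ (ih m (by omega))
      exact fun L hL => ⟨m, hm, hml, hL⟩
    refine map_mem_of_single_mem _ _ ?_ h1
    rintro L ⟨m, hm, hml, hL, S, rfl, hS, hSm⟩
    rw [cone_single]
    have hlen : (b l :: S.map b).length = l.length := by rw [List.length_cons, hL, hml]
    refine single_mem_supported F (1 : F) (s := subdivLists b l) ⟨hlen, l :: S, rfl, ?_, ?_⟩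
    · exact List.pairwise_cons.2 ⟨fun a ha => (hSm a ha).1.trans hm, hS⟩
    · intro a ha
      rcases List.mem_cons.1 ha with rfl | ha
      · exact ⟨List.Sublist.refl _, by rintro rfl; simp at hl⟩
      · exact ⟨(hSm a ha).1.trans hm, (hSm a ha).2⟩

open Classical in
/-- The operator killing all lists with a repetition. -/
noncomputable def normalize : Chain F X →ₗ[F] Chain F X :=
  linearCombination F fun l => if l.Nodup then single l 1 else 0

theorem normalize_of_nodup {l : List X} (hl : l.Nodup) (a : F) :
    normalize (single l a) = single l a := by
  simp [normalize, hl]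

theorem normalize_of_not_nodup {l : List X} (hl : ¬ l.Nodup) (a : F) :
    normalize (single l a) = 0 := by
  simp [normalize, hl]

theorem normalize_cone (x : X) (c : Chain F X) :
    normalize (cone x (normalize c)) = normalize (cone x c) := by
  have : normalize ∘ₗ cone x ∘ₗ normalize = normalize ∘ₗ (cone x : Chain F X →ₗ[F] _) := by
    refine lhom_ext_one fun l => ?_
    simp only [LinearMap.comp_apply]
    by_cases hl : l.Nodup
    · rw [normalize_of_nodup hl]
    · rw [normalize_of_not_nodup hl, cone_single, normalize_of_not_nodup, map_zero, map_zero]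
      exact fun h => hl (List.nodup_cons.1 h).2
  exact LinearMap.congr_fun this c

/-- In a sorted list equal entries are adjacent, so the two facets omitting one of them cancel and
every remaining facet still has a repetition. This makes `normalize` a chain map on decreasing
lists; without sorting it would fail. -/
theorem normalize_bd_of_not_nodup [PartialOrder X] (l : List X) (hs : l.Pairwise (· ≥ ·))
    (hl : ¬ l.Nodup) : normalize (bd (single l (1 : F))) = 0 := by
  induction l with
  | nil => simp at hl
  | cons x l ih =>
    have e : single (x :: l) (1 : F) = cone x (single l 1) := by simp
    obtain ⟨hx, hs'⟩ := List.pairwise_cons.1 hs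
    by_cases hl' : l.Nodup
    · have hxl : x ∈ l := by
        by_contra h
        exact hl (List.nodup_cons.2 ⟨h, hl'⟩)
      cases l with
      | nil => simp at hxl
      | cons y m =>
        have hxy : x = y := by
          rcases List.mem_cons.1 hxl with h | h
          · exact h
          · exact le_antisymm ((List.pairwise_cons.1 hs').1 x h) (hx y (by simp))
        subst hxy
        have e' : single (x :: m) (1 : F) = cone x (single m 1) := by simp
        have h : normalize ∘ₗ cone x ∘ₗ (cone x : Chain F X →ₗ[F] _) = 0 := by
          refine lhom_ext_one fun l => ?_
          simp only [LinearMap.comp_apply, cone_single]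
          exact normalize_of_not_nodup (by simp) _
        rw [e, bd_cone, e', bd_cone, (cone x : Chain F X →ₗ[F] _).map_sub, sub_sub_cancel]
        exact LinearMap.congr_fun h _
    · rw [e, bd_cone, map_sub, normalize_of_not_nodup hl', ← normalize_cone, ih hs' hl']
      simp

theorem bd_normalize [PartialOrder X] {c : Chain F X}
    (hc : c ∈ supported F F {l : List X | l.Pairwise (· ≥ ·)}) :
    bd (normalize c) = normalize (bd c) := by
  rw [← LinearMap.comp_apply, ← LinearMap.comp_apply]
  refine eq_of_eq_on_single _ _ ?_ hc
  intro l hl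
  simp only [LinearMap.comp_apply]
  by_cases h : l.Nodup
  · rw [normalize_of_nodup h]
    refine eq_of_eq_on_single LinearMap.id normalize ?_ (bd_single_mem (F := F) l)
    rintro m ⟨hm, -⟩
    rw [normalize_of_nodup (hm.nodup h)]
    rfl
  · rw [normalize_of_not_nodup h, normalize_bd_of_not_nodup l hl h, map_zero]

end Boundary

/-! ### Equivariance of the chain operators -/

section Action

variable {F G X Y : Type*} [CommRing F] [Group G] [MulAction G X] [MulAction G Y]

/-- The diagonal action on lists. -/
instance listMulAction : MulAction G (List X) where
  smul g l := l.map (g • ·)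
  one_smul l := by
    change l.map ((1 : G) • ·) = l
    simp
  mul_smul g h l := by
    change l.map ((g * h) • ·) = (l.map (h • ·)).map (g • ·)
    simp [mul_smul, Function.comp_def]

theorem smul_list (g : G) (l : List X) : g • l = l.map (g • ·) := rfl

/-- The action of `G` on formal combinations. -/
noncomputable def act (F : Type*) [CommRing F] {α : Type*} [MulAction G α] (g : G) :
    (α →₀ F) →ₗ[F] (α →₀ F) := lmapDomain F F (g • ·)

theorem act_single {α : Type*} [MulAction G α] (g : G) (a : α) (t : F) :
    act F g (single a t) = single (g • a) t := by
  simp [act]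

theorem act_mul {α : Type*} [MulAction G α] (g h : G) (c : α →₀ F) :
    act F (g * h) c = act F g (act F h c) := by
  have : act F (g * h) = act F g ∘ₗ (act F h : (α →₀ F) →ₗ[F] _) := by
    refine lhom_ext_one fun a => ?_
    simp only [LinearMap.comp_apply, act_single, mul_smul]
  exact LinearMap.congr_fun this c

theorem act_one {α : Type*} [MulAction G α] (c : α →₀ F) : act F (1 : G) c = c := by
  have : act F (1 : G) = (LinearMap.id : (α →₀ F) →ₗ[F] _) := by
    refine lhom_ext_one fun a => ?_
    simp only [LinearMap.id_apply, act_single, one_smul]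
  exact LinearMap.congr_fun this c

theorem act_cone (g : G) (x : X) (c : Chain F X) :
    act F g (cone x c) = cone (g • x) (act F g c) := by
  have : act F g ∘ₗ cone x = cone (g • x) ∘ₗ act F g := by
    refine lhom_ext_one fun l => ?_
    simp only [LinearMap.comp_apply, cone_single, act_single]
    rfl
  exact LinearMap.congr_fun this c

theorem bd_act (g : G) (c : Chain F X) : bd (act F g c) = act F g (bd c) := by
  have : bd ∘ₗ act F g = act F g ∘ₗ (bd : Chain F X →ₗ[F] _) := by
    refine lhom_ext_one fun l => ?_
    induction l with
    | nil =>
      simp only [LinearMap.comp_apply, act_single, bd_nil, map_zero]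
      exact bd_nil 1
    | cons x l ih =>
      have e : single (x :: l) (1 : F) = cone x (single l 1) := by simp
      simp only [LinearMap.comp_apply] at ih ⊢
      rw [e, act_cone, bd_cone, bd_cone, map_sub, act_cone, ih]
  exact LinearMap.congr_fun this c

theorem subdiv_act (b : List X → Y) (hb : ∀ (g : G) l, b (g • l) = g • b l) (n : ℕ) (g : G)
    (c : Chain F X) : subdiv b n (act F g c) = act F g (subdiv b n c) := by
  have : subdiv b n ∘ₗ act F g = act F g ∘ₗ (subdiv b n : Chain F X →ₗ[F] _) := by
    induction n with
    | zero =>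
      refine lhom_ext_one fun l => ?_
      simp only [LinearMap.comp_apply, act_single, subdiv, lapply_apply, lsingle_apply]
      cases l with
      | nil => simp [smul_list]
      | cons x l => simp [smul_list]
    | succ n ih =>
      refine lhom_ext_one fun l => ?_
      have h := LinearMap.congr_fun ih (bd (single l 1))
      simp only [LinearMap.comp_apply] at h
      simp only [LinearMap.comp_apply, act_single, subdiv_succ_single, act_cone, hb, ← h, ← bd_act]
  exact LinearMap.congr_fun this c

theorem normalize_act (g : G) (c : Chain F X) :
    normalize (act F g c) = act F g (normalize c) := by
  have : normalize ∘ₗ act F g = act F g ∘ₗ (normalize : Chain F X →ₗ[F] _) := by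
    refine lhom_ext_one fun l => ?_
    simp only [LinearMap.comp_apply, act_single]
    have hiff : (g • l).Nodup ↔ l.Nodup := List.nodup_map_iff (MulAction.injective g)
    by_cases hl : l.Nodup
    · rw [normalize_of_nodup hl, normalize_of_nodup (hiff.2 hl), act_single]
    · rw [normalize_of_not_nodup hl, normalize_of_not_nodup (mt hiff.1 hl), map_zero]
  exact LinearMap.congr_fun this c

theorem act_apply_nil (g : G) (c : Chain F X) : act F g c [] = c [] := by
  have : lapply [] ∘ₗ act F g = (lapply [] : Chain F X →ₗ[F] F) := by
    refine lhom_ext_one fun l => ?_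
    simp only [LinearMap.comp_apply, act_single, lapply_apply]
    cases l <;> simp [smul_list]
  exact LinearMap.congr_fun this c

end Action

/-! ### The periodic resolution of a cyclic group and the descent argument -/

section Periodicity

variable {F G α β X Y : Type*} [CommRing F] [Group G] [Fintype G] [MulAction G α] [MulAction G β]
  [MulAction G X] [MulAction G Y]

/-- The operators `γ - 1` (for even `n`) and `∑ g` (for odd `n`) of the periodic resolution of a
cyclic group with generator `γ`. -/
noncomputable def periodic (F : Type*) [CommRing F] {α : Type*} [MulAction G α] (γ : G) (n : ℕ) :
    (α →₀ F) →ₗ[F] (α →₀ F) :=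
  if Even n then act F γ - LinearMap.id else ∑ g : G, act F g

theorem periodic_even {γ : G} {n : ℕ} (hn : Even n) (c : α →₀ F) :
    periodic F γ n c = act F γ c - c := by
  simp [periodic, hn]

theorem periodic_odd {γ : G} {n : ℕ} (hn : ¬ Even n) (c : α →₀ F) :
    periodic F γ n c = ∑ g : G, act F g c := by
  simp [periodic, hn]

theorem periodic_comm (f : (α →₀ F) →ₗ[F] (β →₀ F)) (c : α →₀ F)
    (hf : ∀ g : G, f (act F g c) = act F g (f c)) (γ : G) (n : ℕ) :
    f (periodic F γ n c) = periodic F γ n (f c) := by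
  by_cases hn : Even n
  · rw [periodic_even hn, periodic_even hn, map_sub, hf]
  · rw [periodic_odd hn, periodic_odd hn, map_sum]
    exact Finset.sum_congr rfl fun g _ => hf g

theorem periodic_mem {γ : G} (n : ℕ) {s : Set α} (hs : ∀ (g : G), ∀ a ∈ s, g • a ∈ s)
    {c : α →₀ F} (hc : c ∈ supported F F s) : periodic F γ n c ∈ supported F F s := by
  have hact : ∀ g : G, act F g c ∈ supported F F s := fun g =>
    map_mem_of_single_mem _ _ (fun a ha => by
      rw [act_single]
      exact single_mem_supported _ _ (hs g a ha)) hc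
  by_cases hn : Even n
  · rw [periodic_even hn]
    exact sub_mem (hact γ) hc
  · rw [periodic_odd hn]
    exact sum_mem fun g _ => hact g

theorem periodic_periodic (γ : G) (n : ℕ) (c : α →₀ F) :
    periodic F γ (n + 1) (periodic F γ n c) = 0 := by
  by_cases hn : Even n
  · rw [periodic_odd (by simpa [Nat.even_add_one] using hn), periodic_even hn]
    simp only [map_sub, Finset.sum_sub_distrib, ← act_mul]
    rw [sub_eq_zero]
    exact Fintype.sum_equiv (Equiv.mulRight γ) _ _ fun g => rfl
  · rw [periodic_even (by simpa [Nat.even_add_one] using hn), periodic_odd hn]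
    simp only [map_sum, ← act_mul]
    rw [sub_eq_zero]
    exact Fintype.sum_equiv (Equiv.mulLeft γ) _ _ fun g => rfl

-- Freeness of the module: `π` keeps the coefficients on a set of orbit representatives, and each
-- element of `s` is a unique translate of its representative.
open Classical in
theorem exists_transversal_projection {s : Set α}
    (hfree : ∀ a ∈ s, ∀ g : G, g • a = a → g = 1) :
    ∃ π : (α →₀ F) →ₗ[F] (α →₀ F), (∀ c ∈ supported F F s, π c ∈ supported F F s) ∧
      ∀ c ∈ supported F F s, ∑ g : G, act F g (π (act F g⁻¹ c)) = c := by
  let A : Set α := {a | (Quotient.mk (MulAction.orbitRel G α) a).out = a}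
  refine ⟨linearCombination F fun a => if a ∈ A then single a 1 else 0, ?_, ?_⟩
  · intro c hc
    refine map_mem_of_single_mem _ _ ?_ hc
    intro a ha
    by_cases h : a ∈ A
    · simpa [h] using single_mem_supported F (1 : F) ha
    · simp [h]
  · intro c hc
    have := eq_of_eq_on_single (∑ g : G, act F g ∘ₗ
      (linearCombination F fun a => if a ∈ A then single a (1 : F) else 0) ∘ₗ act F g⁻¹)
      LinearMap.id ?_ hc
    · simpa only [LinearMap.sum_apply, LinearMap.comp_apply, LinearMap.id_apply] using this
    · intro a ha
      simp only [LinearMap.sum_apply, LinearMap.comp_apply, LinearMap.id_apply, act_single,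
        linearCombination_single, one_smul]
      obtain ⟨h, hh⟩ : ∃ h : G, h • a = (Quotient.mk (MulAction.orbitRel G α) a).out := by
        have := Quotient.mk_out (s := MulAction.orbitRel G α) a
        exact MulAction.orbitRel_apply.1 this
      have hA : ∀ g : G, g⁻¹ • a ∈ A ↔ g = h⁻¹ := by
        intro g
        have hq : (Quotient.mk (MulAction.orbitRel G α) (g⁻¹ • a)) =
            Quotient.mk (MulAction.orbitRel G α) a :=
          Quotient.sound (s := MulAction.orbitRel G α) ⟨g⁻¹, rfl⟩
        change (Quotient.mk (MulAction.orbitRel G α) (g⁻¹ • a)).out = g⁻¹ • a ↔ _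
        rw [hq, ← hh]
        constructor
        · intro e
          have : (g * h) • a = a := by rw [mul_smul, e, smul_inv_smul]
          exact eq_inv_of_mul_eq_one_left (hfree a ha _ this)
        · rintro rfl
          simp
      rw [Finset.sum_eq_single h⁻¹]
      · rw [if_pos ((hA _).2 rfl), act_single, smul_inv_smul]
      · intro g _ hg
        rw [if_neg (mt (hA g).1 hg), map_zero]
      · simp

/-- An invariant `c` is the norm of `π c`. If the norm of `c` vanishes, then `∑ π(g⁻¹c) = 0`, so `c
= ∑ (g - 1) π(g⁻¹c)`, and each `g - 1 = γ ^ i - 1` factors through `γ - 1`. -/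
theorem periodic_exact {γ : G} (hγ : ∀ g : G, ∃ i : ℕ, γ ^ i = g) {s : Set α}
    (hs : ∀ (g : G), ∀ a ∈ s, g • a ∈ s) (hfree : ∀ a ∈ s, ∀ g : G, g • a = a → g = 1) (n : ℕ)
    {c : α →₀ F} (hc : c ∈ supported F F s) (h : periodic F γ n c = 0) :
    ∃ y ∈ supported F F s, periodic F γ (n + 1) y = c := by
  obtain ⟨π, hπ, hsum⟩ := exists_transversal_projection (F := F) hfree
  have hact : ∀ (g : G), ∀ c ∈ supported F F s, act F g c ∈ supported F F s := fun g c hc =>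
    map_mem_of_single_mem _ _ (fun a ha => by
      rw [act_single]
      exact single_mem_supported _ _ (hs g a ha)) hc
  by_cases hn : Even n
  · have hfix : ∀ i : ℕ, act F (γ ^ i) c = c := by
      intro i
      induction i with
      | zero => rw [pow_zero, act_one]
      | succ i ih =>
        rw [periodic_even hn, sub_eq_zero] at h
        rw [pow_succ, act_mul, h, ih]
    refine ⟨π c, hπ c hc, ?_⟩
    rw [periodic_odd (by simpa [Nat.even_add_one] using hn)]
    conv_rhs => rw [← hsum c hc]
    refine Finset.sum_congr rfl fun g _ => ?_
    obtain ⟨i, hi⟩ := hγ g⁻¹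
    rw [← hi, hfix]
  · have key : ∀ i : ℕ, ∀ u ∈ supported F F s, ∃ y ∈ supported F F s,
        periodic F γ (n + 1) y = act F (γ ^ i) u - u := by
      intro i u hu
      induction i with
      | zero => exact ⟨0, zero_mem _, by rw [pow_zero, act_one, map_zero, sub_self]⟩
      | succ i ih =>
        obtain ⟨y, hy, e⟩ := ih
        -- Telescoping: `γ ^ (i+1) - 1 = (γ ^ i - 1) + (γ - 1) γ ^ i`.
        refine ⟨y + act F (γ ^ i) u, add_mem hy (hact _ _ hu), ?_⟩
        rw [map_add, e, periodic_even (by simpa [Nat.even_add_one] using hn), pow_succ', act_mul]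
        abel
    have h0 : ∑ g : G, π (act F g⁻¹ c) = 0 := by
      rw [periodic_odd hn] at h
      rw [← map_sum π, Fintype.sum_equiv (Equiv.inv G) (fun g => act F g⁻¹ c)
        (fun g => act F g c) fun g => rfl, h, map_zero]
    choose! i hi using hγ
    choose! y hy e using key
    refine ⟨∑ g : G, y (i g) (π (act F g⁻¹ c)), sum_mem fun g _ => hy _ _ (hπ _ (hact _ _ hc)), ?_⟩
    rw [map_sum]
    conv_rhs => rw [← hsum c hc, ← sub_zero (∑ g : G, _), ← h0, ← Finset.sum_sub_distrib]
    refine Finset.sum_congr rfl fun g _ => ?_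
    rw [e _ _ (hπ _ (hact _ _ hc)), hi]

/-- A sequence of chains which is the image of the generators of the periodic resolution. -/
def IsPeriodicSeq (γ : G) (h : ℕ → Chain F X) : Prop :=
  bd (h 0) = single [] 1 ∧ ∀ n, bd (h (n + 1)) = periodic F γ n (h n)

theorem IsPeriodicSeq.subdiv {γ : G} {h : ℕ → Chain F X} (hh : IsPeriodicSeq γ h)
    (b : List X → Y) (hb : ∀ (g : G) l, b (g • l) = g • b l) :
    IsPeriodicSeq γ fun n => subdiv b (n + 1) (h n) := by
  refine ⟨?_, fun n => ?_⟩
  · rw [bd_subdiv, hh.1]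
    simp [ListChain.subdiv]
  · rw [bd_subdiv, hh.2, periodic_comm _ _ (fun g => subdiv_act b hb _ g _)]

/-- The iterated cones `v (n+1) * (periodic n (⋯ v 0))`. -/
noncomputable def coneSeq (F : Type*) [CommRing F] (γ : G) (v : ℕ → X) : ℕ → Chain F X
  | 0 => single [v 0] 1
  | n + 1 => cone (v (n + 1)) (periodic F γ n (coneSeq F γ v n))

/-- The base of each cone is a cycle because consecutive periodic operators compose to zero; in
degree `0` because `γ - 1` kills the empty list. -/
theorem isPeriodicSeq_coneSeq (γ : G) (v : ℕ → X) : IsPeriodicSeq γ (coneSeq F γ v) := by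
  have h0 : bd (coneSeq F γ v 0) = single [] 1 := by
    have e : single [v 0] (1 : F) = cone (v 0) (single [] 1) := by simp
    rw [coneSeq, e, bd_cone]
    simp
  refine ⟨h0, fun n => ?_⟩
  rw [coneSeq, bd_cone, periodic_comm _ _ (fun g => bd_act g _), sub_eq_self]
  induction n with
  | zero =>
    rw [h0, periodic_even (by simp), act_single]
    simp [smul_list]
  | succ n ih =>
    rw [coneSeq, bd_cone, periodic_comm _ _ (fun g => bd_act g _), ih, sub_zero,
      periodic_periodic, map_zero]

/-- Strictly decreasing lists of length `n` with entries in `S`. -/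
def strictLists [Preorder X] (S : Set X) (n : ℕ) : Set (List X) :=
  {l | l.length = n ∧ l.Pairwise (· > ·) ∧ ∀ x ∈ l, x ∈ S}

theorem bd_mem_supported_strictLists [Preorder X] {S : Set X} {n : ℕ} {c : Chain F X}
    (hc : c ∈ supported F F (strictLists S (n + 1))) :
    bd c ∈ supported F F (strictLists S n) := by
  refine map_mem_of_single_mem _ _ ?_ hc
  rintro l ⟨hl, hs, hS⟩
  refine supported_mono ?_ (bd_single_mem l)
  rintro m ⟨hm, hml⟩
  exact ⟨by omega, hs.sublist hm, fun x hx => hS x (hm.subset hx)⟩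

theorem normalize_mem_supported_strictLists [PartialOrder X] {S : Set X} {n : ℕ} {c : Chain F X}
    (hc : c ∈ supported F F
      {l : List X | l.length = n ∧ l.Pairwise (· ≥ ·) ∧ ∀ x ∈ l, x ∈ S}) :
    normalize c ∈ supported F F (strictLists S n) := by
  refine map_mem_of_single_mem _ _ ?_ hc
  rintro l ⟨hl, hs, hS⟩
  by_cases h : l.Nodup
  · rw [normalize_of_nodup h]
    refine single_mem_supported F (1 : F) (s := strictLists S n) ⟨hl, ?_, hS⟩
    exact (hs.and h).imp fun hab => lt_of_le_of_ne hab.1 (Ne.symm hab.2)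
  · rw [normalize_of_not_nodup h]
    exact zero_mem _

/-- In a poset with a free action of a cyclic group `G`, whose order vanishes in `F`, a periodic
sequence of decreasing lists forces strictly decreasing lists of the same length. -/
theorem exists_strict_chain_of_isPeriodicSeq [PartialOrder X] [Nontrivial F]
    (hcard : (Fintype.card G : F) = 0) {γ : G} (hγ : ∀ g : G, ∃ i : ℕ, γ ^ i = g)
    (hmono : ∀ (g : G) (a b : X), a ≤ b → g • a ≤ g • b) {S : Set X}
    (hS : ∀ (g : G), ∀ a ∈ S, g • a ∈ S) (hfree : ∀ a ∈ S, ∀ g : G, g • a = a → g = 1)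
    {h : ℕ → Chain F X} (hh : IsPeriodicSeq γ h) (k : ℕ)
    (hsupp : ∀ n ≤ k, h n ∈ supported F F
      {l : List X | l.length = n + 1 ∧ l.Pairwise (· ≥ ·) ∧ ∀ x ∈ l, x ∈ S}) :
    ∃ l : List X, l.length = k + 1 ∧ l.Pairwise (· > ·) ∧ ∀ x ∈ l, x ∈ S := by
  by_contra hno
  have hM : ∀ n ≤ k, normalize (h n) ∈ supported F F (strictLists S (n + 1)) := fun n hn =>
    normalize_mem_supported_strictLists (hsupp n hn)
  have hbd : ∀ n ≤ k, bd (normalize (h n)) = normalize (bd (h n)) := fun n hn =>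
    bd_normalize (supported_mono (fun l hl => hl.2.1) (hsupp n hn))
  have hsucc : ∀ n < k, bd (normalize (h (n + 1))) = periodic F γ n (normalize (h n)) := by
    intro n hn
    rw [hbd _ hn, hh.2, periodic_comm _ _ (fun g => normalize_act g _)]
  have hk : normalize (h k) = 0 := by
    have he : strictLists S (k + 1) = ∅ := Set.eq_empty_iff_forall_notMem.2 fun l hl => hno ⟨l, hl⟩
    simpa [he, supported_empty] using hM k le_rfl
  have hinv : ∀ n (g : G), ∀ l ∈ strictLists S n, g • l ∈ strictLists S n := by
    rintro n g l ⟨hl, hs, hlS⟩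
    refine ⟨by simpa [smul_list] using hl, ?_, ?_⟩
    · rw [smul_list, List.pairwise_map]
      refine hs.imp fun {a b} hab => lt_of_le_of_ne (hmono g _ _ (le_of_lt hab)) fun e => ?_
      exact hab.ne (MulAction.injective g e)
    · intro x hx
      obtain ⟨y, hy, rfl⟩ := List.mem_map.1 hx
      exact hS g y (hlS y hy)
  have hfr : ∀ n, ∀ l ∈ strictLists S (n + 1), ∀ g : G, g • l = l → g = 1 := by
    rintro n l ⟨hl, hs, hlS⟩ g hg
    cases l with
    | nil => simp at hl
    | cons x l =>
      rw [smul_list, List.map_cons, List.cons.injEq] at hg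
      exact hfree x (hlS x (by simp)) g hg.1
  -- Descending induction from `n = k`, where the normalized chain is zero. Exactness writes the
  -- corrected chain in degree `n + 1` as a periodic image of some `z`; taking boundaries makes `bd
  -- z` the correction in degree `n`.
  have main : ∀ j n, n + j = k → ∃ y ∈ supported F F (strictLists S (n + 2)),
      periodic F γ n (normalize (h n) - bd y) = 0 := by
    intro j
    induction j with
    | zero =>
      rintro n rfl
      exact ⟨0, zero_mem _, by rw [show n = n + 0 from rfl, hk]; simp⟩
    | succ j ih =>
      intro n hn
      obtain ⟨y, hy, e⟩ := ih (n + 1) (by omega)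
      obtain ⟨z, hz, e'⟩ := periodic_exact hγ (hinv (n + 2)) (hfr (n + 1)) (n + 1)
        (sub_mem (hM (n + 1) (by omega)) (bd_mem_supported_strictLists hy)) e
      refine ⟨z, hz, ?_⟩
      have e2 := congrArg bd e'
      rw [periodic_comm _ _ (fun g => bd_act g _), map_sub, bd_bd, sub_zero,
        hsucc n (by omega)] at e2
      have hpar : periodic F γ (n + 1 + 1) (bd z) = periodic F γ n (bd z) := by
        simp [periodic, Nat.even_add_one]
      rw [map_sub, ← e2, hpar, sub_self]
  obtain ⟨y, hy, e⟩ := main k 0 (by omega)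
  obtain ⟨z, hz, e'⟩ := periodic_exact hγ (hinv 1) (hfr 0) 0
    (sub_mem (hM 0 (by omega)) (bd_mem_supported_strictLists hy)) e
  have e2 := congrArg bd e'
  rw [periodic_comm _ _ (fun g => bd_act g _), map_sub, bd_bd, sub_zero, hbd 0 (by omega), hh.1,
    normalize_of_nodup List.nodup_nil, periodic_odd (by simp)] at e2
  -- Coefficient of the empty list: `1` on one side, a multiple of `|G|`, hence `0`, on the other.
  have e3 := DFunLike.congr_fun e2 []
  simp [Finsupp.finsetSum_apply, act_apply_nil, hcard] at e3

end Periodicity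

end ListChain

namespace ListChain

open Finsupp

/-! ### Means and the mesh of barycentric subdivision -/

section Mean

/-- The arithmetic mean of a list of vectors. -/
noncomputable def mean {E : Type*} [AddCommGroup E] [Module ℝ E] (l : List E) : E :=
  (l.length : ℝ)⁻¹ • l.sum

variable {E : Type*} [AddCommGroup E] [Module ℝ E]

theorem map_mean {E' : Type*} [AddCommGroup E'] [Module ℝ E'] (f : E →ₗ[ℝ] E') (l : List E) :
    f (mean l) = mean (l.map f) := by
  simp [mean, map_list_sum]

theorem abs_sum_sub_le {l : List ℝ} {a B : ℝ} (h : ∀ x ∈ l, |x - a| ≤ B) :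
    |l.sum - l.length * a| ≤ l.length * B := by
  induction l with
  | nil => simp
  | cons x l ih =>
    have h1 := ih fun y hy => h y (by simp [hy])
    have h2 := h x (by simp)
    have e : (x :: l).sum - ((x :: l).length : ℝ) * a = (x - a) + (l.sum - l.length * a) := by
      push_cast [List.sum_cons, List.length_cons]
      ring
    rw [e]
    refine (abs_add_le _ _).trans ?_
    push_cast [List.length_cons]
    linarith

theorem mean_sub_eq {l : List ℝ} (hl : l ≠ []) (a : ℝ) :
    mean l - a = (l.length : ℝ)⁻¹ * (l.sum - l.length * a) := by
  have : (l.length : ℝ) ≠ 0 := by simpa using hl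
  simp only [mean, smul_eq_mul]
  field_simp

theorem abs_mean_sub_le {l : List ℝ} (hl : l ≠ []) {a B : ℝ} (h : ∀ x ∈ l, |x - a| ≤ B) :
    |mean l - a| ≤ B := by
  have hpos : (0 : ℝ) < l.length := by simpa [List.length_pos_iff] using hl
  rw [mean_sub_eq hl, abs_mul, abs_of_pos (inv_pos.2 hpos), inv_mul_le_iff₀ hpos]
  exact abs_sum_sub_le h

/-- One entry equals `a` and contributes no error, so at most `k` of `k + 1` summands count. This is
the contraction factor of subdivision. -/
theorem abs_mean_sub_le_of_mem {l : List ℝ} {k : ℕ} (hk : l.length ≤ k + 1) {a B : ℝ} (ha : a ∈ l)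
    (h : ∀ x ∈ l, |x - a| ≤ B) : |mean l - a| ≤ (k / (k + 1) : ℝ) * B := by
  have hl : l ≠ [] := List.ne_nil_of_mem ha
  have hpos : (0 : ℝ) < l.length := by simpa [List.length_pos_iff] using hl
  have hB : 0 ≤ B := (abs_nonneg _).trans (h a ha)
  have hp := List.perm_cons_erase ha
  have hsum : l.sum = a + (l.erase a).sum := by rw [hp.sum_eq, List.sum_cons]
  have hlen : l.length = (l.erase a).length + 1 := by rw [hp.length_eq, List.length_cons]
  have h1 := abs_sum_sub_le (l := l.erase a) (a := a) (B := B)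
    fun x hx => h x (List.mem_of_mem_erase hx)
  have e : l.sum - l.length * a = (l.erase a).sum - (l.erase a).length * a := by
    rw [hsum, hlen]
    push_cast
    ring
  rw [mean_sub_eq hl, abs_mul, abs_of_pos (inv_pos.2 hpos), inv_mul_le_iff₀ hpos, e]
  refine h1.trans ?_
  rw [← mul_assoc]
  refine mul_le_mul_of_nonneg_right ?_ hB
  have hk' : ((l.erase a).length : ℝ) ≤ k := by
    exact_mod_cast (by omega : (l.erase a).length ≤ k)
  rw [hlen, ← mul_div_assoc, le_div_iff₀ (by positivity)]
  push_cast
  nlinarith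

end Mean

section Fine

variable {V : Type*}

/-- A list of points of the polyhedron of `K` is `ε`-fine if its entries lie in a common face and
their barycentric coordinates differ by at most `ε`. -/
def IsFine (K : AbstractSimplicialComplex V) (ε : ℝ) (l : List (V → ℝ)) : Prop :=
  (∃ s ∈ K.faces, ∀ x ∈ l, (∀ v, 0 ≤ x v) ∧ (∀ v, v ∉ s → x v = 0) ∧ ∑ v ∈ s, x v = 1) ∧
    ∀ x ∈ l, ∀ y ∈ l, ∀ v, |x v - y v| ≤ ε

variable {K : AbstractSimplicialComplex V}

theorem mean_apply (l : List (V → ℝ)) (v : V) : mean l v = mean (l.map fun x => x v) :=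
  map_mean (LinearMap.proj v) l

theorem mean_nonneg {l : List ℝ} (h : ∀ x ∈ l, 0 ≤ x) : 0 ≤ mean l :=
  smul_nonneg (by positivity) (List.sum_nonneg h)

theorem mean_eq_of_forall {l : List ℝ} (hl : l ≠ []) {a : ℝ} (h : ∀ x ∈ l, x = a) :
    mean l = a := by
  have := abs_mean_sub_le hl (a := a) (B := 0) fun x hx => by simp [h x hx]
  simpa [sub_eq_zero] using this

/-- For nested `m' ⊆ m`, each entry of `m'` is also an entry of `m`, hence within `k/(k+1) · ε` of
the mean of `m`; averaging over `m'` keeps the bound. -/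
theorem IsFine.mean {ε : ℝ} {l : List (V → ℝ)} (hl : IsFine K ε l) {k : ℕ}
    (hk : l.length ≤ k + 1) {S : List (List (V → ℝ))}
    (hS : S.Pairwise fun m m' => m'.Sublist m) (hSl : ∀ m ∈ S, m.Sublist l ∧ m ≠ []) :
    IsFine K ((k / (k + 1) : ℝ) * ε) (S.map ListChain.mean) := by
  obtain ⟨⟨s, hs, hls⟩, hd⟩ := hl
  refine ⟨⟨s, hs, ?_⟩, ?_⟩
  · intro x hx
    obtain ⟨m, hm, rfl⟩ := List.mem_map.1 hx
    obtain ⟨hml, hm0⟩ := hSl m hm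
    refine ⟨fun v => ?_, fun v hv => ?_, ?_⟩
    · rw [mean_apply]
      refine mean_nonneg fun t ht => ?_
      obtain ⟨y, hy, rfl⟩ := List.mem_map.1 ht
      exact (hls y (hml.subset hy)).1 v
    · rw [mean_apply]
      refine mean_eq_of_forall (by simpa using hm0) fun t ht => ?_
      obtain ⟨y, hy, rfl⟩ := List.mem_map.1 ht
      exact (hls y (hml.subset hy)).2.1 v hv
    · have e := map_mean (∑ v ∈ s, LinearMap.proj (R := ℝ) (φ := fun _ : V => ℝ) v) m
      simp only [LinearMap.sum_apply, LinearMap.proj_apply] at e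
      rw [e]
      refine mean_eq_of_forall (by simpa using hm0) fun t ht => ?_
      obtain ⟨y, hy, rfl⟩ := List.mem_map.1 ht
      simpa using (hls y (hml.subset hy)).2.2
  · have key : ∀ m ∈ S, ∀ m' ∈ S, m'.Sublist m → ∀ v,
        |ListChain.mean m v - ListChain.mean m' v| ≤ (k / (k + 1) : ℝ) * ε := by
      intro m hm m' hm' hmm v
      rw [mean_apply, mean_apply, abs_sub_comm]
      refine abs_mean_sub_le (by simpa using (hSl m' hm').2) fun t ht => ?_
      rw [abs_sub_comm]
      refine abs_mean_sub_le_of_mem ?_ ((hmm.map _).subset ht) fun u hu => ?_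
      · rw [List.length_map]
        exact (hSl m hm).1.length_le.trans hk
      · obtain ⟨y, hy, rfl⟩ := List.mem_map.1 ht
        obtain ⟨z, hz, rfl⟩ := List.mem_map.1 hu
        exact hd z ((hSl m hm).1.subset hz) y ((hSl m' hm').1.subset hy) v
    intro x hx y hy v
    obtain ⟨m, hm, rfl⟩ := List.mem_map.1 hx
    obtain ⟨m', hm', rfl⟩ := List.mem_map.1 hy
    have hcomp : m'.Sublist m ∨ m.Sublist m' := by
      have : Std.Symm fun a c : List (V → ℝ) => c.Sublist a ∨ a.Sublist c := ⟨fun _ _ h => h.symm⟩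
      exact List.Pairwise.forall_of_forall
        (R := fun a c : List (V → ℝ) => c.Sublist a ∨ a.Sublist c)
        (fun a _ => Or.inl (List.Sublist.refl a)) (hS.imp fun h => Or.inl h) hm hm'
    rcases hcomp with h | h
    · exact key m hm m' hm' h v
    · rw [abs_sub_comm]
      exact key m' hm' m hm h v

open Classical in
/-- The point of the polyhedron given by a vertex. -/
noncomputable def vertexPoint (v : V) : V → ℝ := Pi.single v 1

theorem isFine_map_vertexPoint [DecidableEq V] {l : List V} (hl : l.toFinset ∈ K.faces) :
    IsFine K 1 (l.map vertexPoint) := by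
  refine ⟨⟨l.toFinset, hl, ?_⟩, ?_⟩
  · intro x hx
    obtain ⟨v, hv, rfl⟩ := List.mem_map.1 hx
    refine ⟨fun w => ?_, fun w hw => ?_, ?_⟩
    · by_cases h : w = v
      · subst h
        simp [vertexPoint]
      · simp [vertexPoint, h]
    · have h : w ≠ v := by
        rintro rfl
        exact hw (List.mem_toFinset.2 hv)
      simp [vertexPoint, h]
    · simp [vertexPoint, hv]
  · intro x hx y hy w
    obtain ⟨v, hv, rfl⟩ := List.mem_map.1 hx
    obtain ⟨v', hv', rfl⟩ := List.mem_map.1 hy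
    by_cases h : w = v <;> by_cases h' : w = v' <;> simp [vertexPoint, Pi.single_apply, h, h']
    all_goals split_ifs <;> simp

end Fine

/-! ### Fine periodic sequences in `E_k G` and the Dold-type theorem -/

section FineSequence

attribute [local instance] arrowAction

variable {G V : Type*} [Group G] [MulAction G V]

theorem arrow_smul_apply (g : G) (x : V → ℝ) (v : V) : (g • x) v = x (g⁻¹ • v) := rfl

theorem smul_mean (g : G) (l : List (V → ℝ)) : mean (g • l) = g • mean l := by
  ext v
  rw [arrow_smul_apply, mean_apply, mean_apply, smul_list, List.map_map]
  rfl

theorem vertexPoint_smul (g : G) (v : V) : vertexPoint (g • v) = g • vertexPoint v := by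
  ext w
  rw [arrow_smul_apply]
  have h : w = g • v ↔ g⁻¹ • w = v := inv_smul_eq_iff.symm
  by_cases hw : w = g • v
  · simp [vertexPoint, hw]
  · simp [vertexPoint, hw, mt h.2 hw]

variable {F : Type*} [CommRing F] [Fintype G]

/-- The vertices `(0, 1), (1, 1), …` of the join complex. -/
def joinVertex (G : Type*) [Group G] (k n : ℕ) : Σ _ : Fin (k + 1), G := ⟨Fin.ofNat (k + 1) n, 1⟩

/-- The apex in degree `n + 1` lies in a copy of `G` not used before, so the lists are faces of the
join. The bound `n ≤ k` keeps the reduction modulo `k + 1` in `joinVertex` harmless. -/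
theorem coneSeq_joinVertex_mem (γ : G) (k n : ℕ) (hn : n ≤ k) :
    coneSeq F γ (joinVertex G k) n ∈ supported F F
      {l : List (Σ _ : Fin (k + 1), G) | l.length = n + 1 ∧ l.Pairwise (fun a c => c.1 < a.1) ∧
        ∀ a ∈ l, (a.1 : ℕ) ≤ n} := by
  have hval : ∀ n ≤ k, ((joinVertex G k n).1 : ℕ) = n := fun n hn =>
    Nat.mod_eq_of_lt (Nat.lt_succ_of_le hn)
  induction n with
  | zero =>
    refine single_mem_supported F (1 : F) ⟨by simp, by simp, fun a ha => ?_⟩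
    rw [List.mem_singleton.1 ha, hval 0 hn]
  | succ n ih =>
    refine map_mem_of_single_mem _ _ ?_ (periodic_mem n ?_ (ih (by omega)))
    · rintro l ⟨hl, hs, hb⟩
      rw [cone_single]
      refine single_mem_supported F (1 : F) ⟨by simp [hl], ?_, ?_⟩
      · refine List.pairwise_cons.2 ⟨fun a ha => ?_, hs⟩
        rw [Fin.lt_def, hval _ hn]
        exact Nat.lt_succ_of_le (hb a ha)
      · intro a ha
        rcases List.mem_cons.1 ha with rfl | ha
        · exact (hval _ hn).le
        · exact (hb a ha).trans (Nat.le_succ n)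
    · rintro g l ⟨hl, hs, hb⟩
      refine ⟨by simpa [smul_list] using hl, ?_, ?_⟩
      · rw [smul_list, List.pairwise_map]
        exact hs
      · intro a ha
        obtain ⟨c, hc, rfl⟩ := List.mem_map.1 ha
        exact hb c hc

/-- Periodic sequences supported on arbitrarily fine lists exist in `E_k G`. -/
theorem exists_isPeriodicSeq_isFine (γ : G) (k N : ℕ) :
    ∃ h : ℕ → Chain F ((Σ _ : Fin (k + 1), G) → ℝ), IsPeriodicSeq γ h ∧ ∀ n ≤ k,
      h n ∈ supported F F
        {l | l.length = n + 1 ∧ IsFine (joinComplex G k) ((k / (k + 1) : ℝ) ^ (N + 1)) l} := by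
  classical
  induction N with
  | zero =>
    refine ⟨_, (isPeriodicSeq_coneSeq γ (joinVertex G k)).subdiv
      (fun l => mean (l.map vertexPoint)) ?_, ?_⟩
    · intro g l
      rw [← smul_mean, smul_list, smul_list, List.map_map, List.map_map]
      congr 2
      funext v
      exact vertexPoint_smul g v
    · intro n hn
      refine map_mem_of_single_mem _ _ ?_ (coneSeq_joinVertex_mem γ k n hn)
      rintro l ⟨hl, hs, hb⟩
      refine supported_mono ?_ (subdiv_single_mem _ (n + 1) l hl)
      rintro L ⟨hL, S, rfl, hS, hSl⟩
      refine ⟨hL.trans hl, ?_⟩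
      have hface : l.toFinset ∈ (joinComplex G k).faces := by
        refine ⟨?_, ?_⟩
        · rw [List.toFinset_nonempty_iff]
          rintro rfl
          simp at hl
        · intro a ha c hc hac
          by_contra hne
          have : Std.Symm fun a c : Σ _ : Fin (k + 1), G => a ≠ c → a.1 ≠ c.1 :=
            ⟨fun _ _ h hne e => h (Ne.symm hne) e.symm⟩
          have h : ∀ ⦃a⦄, a ∈ l → ∀ ⦃c⦄, c ∈ l → a ≠ c → a.1 ≠ c.1 :=
            List.Pairwise.forall_of_forall 
              (R := fun a c : Σ _ : Fin (k + 1), G => a ≠ c → a.1 ≠ c.1)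
              (fun a _ h => (h rfl).elim) (hs.imp fun {a c} h (_ : a ≠ c) => (ne_of_lt h).symm)
          exact h (List.mem_toFinset.1 ha) (List.mem_toFinset.1 hc) hne hac
      have hbase := isFine_map_vertexPoint hface
      have := hbase.mean (k := k) (S := S.map (List.map vertexPoint))
        (by rw [List.length_map]; omega)
        (by
          rw [List.pairwise_map]
          exact hS.imp fun h => h.map _)
        (by
          intro m hm
          obtain ⟨m', hm', rfl⟩ := List.mem_map.1 hm
          exact ⟨(hSl m' hm').1.map _, by simpa using (hSl m' hm').2⟩)
      simpa [Function.comp_def] using this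
  | succ N ih =>
    obtain ⟨h, hh, hsupp⟩ := ih
    refine ⟨_, hh.subdiv mean smul_mean, ?_⟩
    intro n hn
    refine map_mem_of_single_mem _ _ ?_ (hsupp n hn)
    rintro l ⟨hl, hf⟩
    refine supported_mono ?_ (subdiv_single_mem _ (n + 1) l hl)
    rintro L ⟨hL, S, rfl, hS, hSl⟩
    refine ⟨hL.trans hl, ?_⟩
    have := hf.mean (k := k) (by omega) hS hSl
    rwa [← pow_succ'] at this

theorem IsFine.mono {K : AbstractSimplicialComplex V} {ε δ : ℝ} (h : ε ≤ δ) {l : List (V → ℝ)}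
    (hl : IsFine K ε l) : IsFine K δ l :=
  ⟨hl.1, fun x hx y hy v => (hl.2 x hx y hy v).trans h⟩

theorem IsFine.sublist {K : AbstractSimplicialComplex V} {ε : ℝ} {l m : List (V → ℝ)}
    (hl : IsFine K ε l) (hm : m.Sublist l) : IsFine K ε m := by
  obtain ⟨⟨s, hs, h⟩, hd⟩ := hl
  exact ⟨⟨s, hs, fun x hx => h x (hm.subset hx)⟩,
    fun x hx y hy => hd x (hm.subset hx) y (hm.subset hy)⟩

/-- A combinatorial form of Dold's theorem for `E_k G`, `G` of prime order: an equivariant monotone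
labelling of sufficiently fine lists by elements of a poset on which `G` acts freely uses a chain
with `k + 1` elements. -/
theorem exists_strict_chain_of_labelling (hG : (Fintype.card G).Prime) (k : ℕ) {D : Type*}
    [PartialOrder D] [MulAction G D] (hmono : ∀ (g : G) (a b : D), a ≤ b → g • a ≤ g • b)
    (b : List ((Σ _ : Fin (k + 1), G) → ℝ) → D) (hb : ∀ (g : G) l, b (g • l) = g • b l)
    (hbm : ∀ l m, m.Sublist l → b m ≤ b l) {S : Set D} (hS : ∀ (g : G), ∀ a ∈ S, g • a ∈ S)
    (hfree : ∀ a ∈ S, ∀ g : G, g • a = a → g = 1) {δ : ℝ} (hδ : 0 < δ)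
    (hbS : ∀ l ≠ [], IsFine (joinComplex G k) δ l → b l ∈ S) :
    ∃ l : List D, l.length = k + 1 ∧ l.Pairwise (· > ·) ∧ ∀ x ∈ l, x ∈ S := by
  have := Fact.mk hG
  obtain ⟨γ, hγ⟩ : ∃ γ : G, ∀ g : G, ∃ i : ℕ, γ ^ i = g := by
    have : IsCyclic G := isCyclic_of_prime_card (p := Fintype.card G) (Nat.card_eq_fintype_card)
    obtain ⟨γ, hγ⟩ := IsCyclic.exists_generator (α := G)
    exact ⟨γ, fun g => mem_powers_iff_mem_zpowers.2 (hγ g)⟩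
  obtain ⟨N, hN⟩ : ∃ N : ℕ, (k / (k + 1) : ℝ) ^ N < δ :=
    exists_pow_lt_of_lt_one hδ (by rw [div_lt_one (by positivity)]; linarith)
  have hN' : (k / (k + 1) : ℝ) ^ (N + 1) ≤ δ := by
    refine (pow_le_pow_of_le_one (by positivity) ?_ (Nat.le_succ N)).trans hN.le
    rw [div_le_one (by positivity)]
    linarith
  obtain ⟨h, hh, hsupp⟩ := exists_isPeriodicSeq_isFine (F := ZMod (Fintype.card G)) γ k N
  -- The labelling acts as the barycentre choice of one more subdivision: monotonicity turns flags
  -- of sublists into decreasing lists of labels.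
  refine exists_strict_chain_of_isPeriodicSeq (F := ZMod (Fintype.card G)) (by simp) hγ hmono hS
    hfree (hh.subdiv b hb) k fun n hn => ?_
  refine map_mem_of_single_mem _ _ ?_ (hsupp n hn)
  rintro l ⟨hl, hf⟩
  refine supported_mono ?_ (subdiv_single_mem b (n + 1) l hl)
  rintro L ⟨hL, T, rfl, hT, hTl⟩
  refine ⟨hL.trans hl, ?_, ?_⟩
  · rw [List.pairwise_map]
    exact hT.imp fun h => hbm _ _ h
  · intro x hx
    obtain ⟨m, hm, rfl⟩ := List.mem_map.1 hx
    exact hbS m (hTl m hm).2 ((hf.mono hN').sublist (hTl m hm).1)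

end FineSequence

end ListChain

/-! ### Compactness of polyhedra and affine extension of simplicial maps -/

section Polyhedra

variable {G V U : Type*} [Group G] [MulAction G V] [MulAction G U]
  {K : AbstractSimplicialComplex V} {K' : AbstractSimplicialComplex U}

theorem isCompact_setOf_realization [Finite V] (K : AbstractSimplicialComplex V) :
    IsCompact {x : V → ℝ | (∀ v, 0 ≤ x v) ∧
      ∃ s ∈ K.faces, (∀ v, v ∉ s → x v = 0) ∧ ∑ v ∈ s, x v = 1} := by
  have := Fintype.ofFinite V
  refine isCompact_Icc.of_isClosed_subset (s := Set.Icc (0 : V → ℝ) 1) ?_ ?_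
  · have e : {x : V → ℝ | (∀ v, 0 ≤ x v) ∧
        ∃ s ∈ K.faces, (∀ v, v ∉ s → x v = 0) ∧ ∑ v ∈ s, x v = 1} =
        (⋂ v, {x | 0 ≤ x v}) ∩
          ⋃ s ∈ K.faces, (⋂ v, ⋂ (_ : v ∉ s), {x | x v = 0}) ∩ {x | ∑ v ∈ s, x v = 1} := by
      ext x
      simp only [Set.mem_ofPred_eq, Set.mem_inter_iff, Set.mem_iInter, Set.mem_iUnion, exists_prop]
    rw [e]
    refine IsClosed.inter (isClosed_iInter fun v => isClosed_le (by fun_prop) (by fun_prop)) ?_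
    refine (Set.toFinite _).isClosed_biUnion fun s _ => IsClosed.inter ?_ ?_
    · exact isClosed_iInter fun v => isClosed_iInter fun _ =>
        isClosed_eq (by fun_prop) (by fun_prop)
    · exact isClosed_eq (by fun_prop) (by fun_prop)
  · rintro x ⟨h0, s, -, hs0, hs1⟩
    refine ⟨h0, fun v => ?_⟩
    by_cases hv : v ∈ s
    · rw [Pi.one_apply, ← hs1]
      exact Finset.single_le_sum (fun w _ => h0 w) hv
    · simp [hs0 v hv]

theorem Realization.exists_modulus [Finite V] [Finite U] {f : Realization K → Realization K'}
    (hf : Continuous f) {ε : ℝ} (hε : 0 < ε) :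
    ∃ δ > 0, ∀ x y : Realization K, (∀ v, |x.1 v - y.1 v| ≤ δ) →
      ∀ u, |(f x).1 u - (f y).1 u| < ε := by
  have := Fintype.ofFinite V
  have := Fintype.ofFinite U
  let A := {x : V → ℝ | (∀ v, 0 ≤ x v) ∧
      ∃ s ∈ K.faces, (∀ v, v ∉ s → x v = 0) ∧ ∑ v ∈ s, x v = 1}
  have hA : CompactSpace A := isCompact_iff_compactSpace.1 (isCompact_setOf_realization K)
  let F : A → U → ℝ := fun x => (f x).1
  have hF : Continuous F := continuous_subtype_val.comp hf
  obtain ⟨δ, hδ, h⟩ := Metric.uniformContinuous_iff.1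
    (CompactSpace.uniformContinuous_of_continuous hF) ε hε
  refine ⟨δ / 2, by positivity, fun x y hxy u => ?_⟩
  have hd : dist (α := A) x y < δ := by
    refine lt_of_le_of_lt ?_ (half_lt_self hδ)
    exact (dist_pi_le_iff (by positivity)).2 hxy
  have := h hd
  exact lt_of_le_of_lt (dist_le_pi_dist (F x) (F y) u) this

theorem Realization.exists_le_apply [Fintype U] (x : Realization K') :
    ∃ u, (Fintype.card U : ℝ)⁻¹ ≤ x.1 u := by
  obtain ⟨h0, s, hs, hs0, hs1⟩ := x.2
  by_contra! h
  obtain ⟨u, hu⟩ := (K'.isRelLowerSet_faces hs).1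
  have hU : (0 : ℝ) < Fintype.card U := by
    exact_mod_cast Fintype.card_pos_iff.2 ⟨u⟩
  have h1 : ∑ v, x.1 v = 1 := by
    refine Eq.trans ?_ hs1
    exact (Finset.sum_subset (Finset.subset_univ s) fun v _ hv => hs0 v hv).symm
  have h2 : ∑ v, x.1 v < ∑ _v : U, (Fintype.card U : ℝ)⁻¹ :=
    Finset.sum_lt_sum_of_nonempty ⟨u, Finset.mem_univ u⟩ fun v _ => h v
  rw [h1] at h2
  simp [hU.ne'] at h2

/-- The affine extension of a simplicial map. -/
noncomputable def Realization.map [Fintype V] [DecidableEq U] (φ : V → U)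
    (hφ : ∀ s ∈ K.faces, s.image φ ∈ K'.faces) (x : Realization K) : Realization K' :=
  ⟨fun u => ∑ v with φ v = u, x.1 v, fun u => Finset.sum_nonneg fun v _ => x.2.1 v, by
    obtain ⟨s, hs, h0, h1⟩ := x.2.2
    refine ⟨s.image φ, hφ s hs, ?_, ?_⟩
    · intro u hu
      refine Finset.sum_eq_zero fun v hv => h0 v fun hvs => hu ?_
      rw [← (Finset.mem_filter.1 hv).2]
      exact Finset.mem_image_of_mem φ hvs
    · refine Eq.trans ?_ h1
      refine Eq.trans ?_ (Finset.sum_fiberwise_of_maps_to (s := s) (t := s.image φ)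
        (fun v hv => Finset.mem_image_of_mem φ hv) x.1)
      refine Finset.sum_congr rfl fun u _ => ?_
      symm
      refine Finset.sum_subset (Finset.filter_subset_filter _ (Finset.subset_univ s)) ?_
      intro v hv hv'
      exact h0 v fun hvs => hv' (Finset.mem_filter.2 ⟨hvs, (Finset.mem_filter.1 hv).2⟩)⟩

theorem Realization.continuous_map [Fintype V] [Finite U] [DecidableEq U] (φ : V → U)
    (hφ : ∀ s ∈ K.faces, s.image φ ∈ K'.faces) :
    Continuous (Realization.map (K := K) (K' := K') φ hφ) := by
  refine Continuous.subtype_mk (continuous_pi fun u => continuous_finsetSum _ fun v _ => ?_) _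
  exact (continuous_apply v).comp continuous_subtype_val

theorem Realization.map_smul [Fintype V] [DecidableEq U] [IsSimplicialAction G K]
    [IsSimplicialAction G K'] (φ : V → U) (hφ : ∀ s ∈ K.faces, s.image φ ∈ K'.faces)
    (he : ∀ (g : G) v, φ (g • v) = g • φ v) (g : G) (x : Realization K) :
    Realization.map (K' := K') φ hφ (g • x) = g • Realization.map φ hφ x := by
  refine Subtype.ext (funext fun u => ?_)
  change ∑ v with φ v = u, x.1 (g⁻¹ • v) = ∑ v with φ v = g⁻¹ • u, x.1 v
  refine Finset.sum_bij' (fun v _ => g⁻¹ • v) (fun v _ => g • v) ?_ ?_ ?_ ?_ ?_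
  · intro v hv
    simp only [Finset.mem_filter, Finset.mem_univ, true_and] at hv ⊢
    rw [he, hv]
  · intro v hv
    simp only [Finset.mem_filter, Finset.mem_univ, true_and] at hv ⊢
    rw [he, hv, smul_inv_smul]
  · simp
  · simp
  · simp

end Polyhedra

/-! ### From continuous equivariant maps to labellings -/

section Labelling

attribute [local instance] arrowAction

open ListChain

variable {G U : Type*} [Group G] [Finite G] [MulAction G U]

/-- A continuous equivariant map from `E_k G` to a polyhedron gives an equivariant monotone
labelling of lists of points by sets of vertices, such that fine lists are labelled by faces. -/
theorem exists_labelling_of_continuous {k : ℕ} [Finite U] {K : AbstractSimplicialComplex U}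
    [IsSimplicialAction G K] {f : EG G k → Realization K} (hf : Continuous f)
    (hfe : ∀ (g : G) x, f (g • x) = g • f x) :
    ∃ lab : List ((Σ _ : Fin (k + 1), G) → ℝ) → Set U,
      (∀ (g : G) l u, u ∈ lab (g • l) ↔ g⁻¹ • u ∈ lab l) ∧
      (∀ l m, m.Sublist l → lab m ⊆ lab l) ∧
      ∃ δ > 0, ∀ l ≠ [], IsFine (joinComplex G k) δ l → ∃ s ∈ K.faces, (s : Set U) = lab l := by
  classical
  have := Fintype.ofFinite U
  let A := {x : (Σ _ : Fin (k + 1), G) → ℝ | (∀ v, 0 ≤ x v) ∧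
    ∃ s ∈ (joinComplex G k).faces, (∀ v, v ∉ s → x v = 0) ∧ ∑ v ∈ s, x v = 1}
  have hA : ∀ (g : G), ∀ x ∈ A, g • x ∈ A := fun g x hx =>
    (g • (show Realization (joinComplex G k) from ⟨x, hx⟩)).2
  -- Coordinates sum to `1`, so every image point has one of size at least `ε`; labels of nonempty
  -- fine lists are therefore nonempty.
  let ε : ℝ := (Fintype.card U : ℝ)⁻¹
  let lab : List ((Σ _ : Fin (k + 1), G) → ℝ) → Set U := fun l =>
    {u | ∃ x ∈ l, ∃ h : x ∈ A, ε ≤ (f ⟨x, h⟩).1 u}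
  have hlab : ∀ (g : G) l u, u ∈ lab l → g • u ∈ lab (g • l) := by
    rintro g l u ⟨x, hx, h, hu⟩
    refine ⟨g • x, List.mem_map_of_mem hx, hA g x h, ?_⟩
    have e : f ⟨g • x, hA g x h⟩ = g • f ⟨x, h⟩ := hfe g ⟨x, h⟩
    rw [e]
    change ε ≤ (f ⟨x, h⟩).1 (g⁻¹ • g • u)
    rwa [inv_smul_smul]
  refine ⟨lab, fun g l u => ⟨fun h => ?_, fun h => ?_⟩, ?_, ?_⟩
  · simpa using hlab g⁻¹ _ _ h
  · simpa using hlab g _ _ h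
  · rintro l m hml u ⟨x, hx, h⟩
    exact ⟨x, hml.subset hx, h⟩
  · have hε : 0 < (if 0 < ε then ε else 1) := by split_ifs <;> simp_all
    obtain ⟨δ, hδ, hmod⟩ := Realization.exists_modulus hf hε
    refine ⟨δ, hδ, ?_⟩
    rintro l hl ⟨⟨t, ht, hlt⟩, hd⟩
    obtain ⟨x, hx⟩ := List.exists_mem_of_ne_nil l hl
    have hmem : ∀ y ∈ l, y ∈ A := fun y hy => ⟨(hlt y hy).1, t, ht, (hlt y hy).2⟩
    obtain ⟨u₀, hu₀⟩ := Realization.exists_le_apply (f ⟨x, hmem x hx⟩)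
    have hεpos : 0 < ε := by
      have : 0 < Fintype.card U := Fintype.card_pos_iff.2 ⟨u₀⟩
      positivity
    rw [if_pos hεpos] at hmod
    obtain ⟨h0, s, hs, hs0, -⟩ := (f ⟨x, hmem x hx⟩).2
    -- Images of points of `l` differ by less than `ε`, so a coordinate that is at least `ε` at one
    -- of them cannot vanish at `f x`.
    have hsub : lab l ⊆ s := by
      rintro u ⟨y, hy, h, hu⟩
      by_contra hus
      have := hmod ⟨y, h⟩ ⟨x, hmem x hx⟩ (hd y hy x hx) u
      rw [hs0 u hus, sub_zero] at this
      exact absurd (hu.trans (le_abs_self _)) (not_le.2 this)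
    refine ⟨s.filter (· ∈ lab l), (K.isRelLowerSet_faces hs).2 (Finset.filter_subset _ _) ?_, ?_⟩
    · exact ⟨u₀, Finset.mem_filter.2 ⟨hsub ⟨x, hx, hmem x hx, hu₀⟩, ⟨x, hx, hmem x hx, hu₀⟩⟩⟩
    · ext u
      simp only [Finset.coe_filter, Set.mem_ofPred_eq]
      exact ⟨fun h => h.2, fun h => ⟨hsub h, h⟩⟩

end Labelling

/-! ### Existence of the maximum defining the co-index -/

section Coindex

variable {G P : Type*} [Group G] [PartialOrder P] [GPoset G P]

/-- Iterating gives `x ≤ g • x ≤ ⋯ ≤ g ^ n • x = x` with `n` the order of `g`. -/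
theorem smul_eq_self_of_comparable [Finite G] {g : G} {x : P} (h : x ≤ g • x ∨ g • x ≤ x) :
    g • x = x := by
  have key : ∀ g : G, x ≤ g • x → g • x = x := by
    intro g h
    have hn : ∀ n : ℕ, g • x ≤ g ^ (n + 1) • x := by
      intro n
      induction n with
      | zero => simp
      | succ n ih =>
        rw [pow_succ', mul_smul]
        exact GPoset.smul_le_smul_of_le g (h.trans ih)
    refine le_antisymm ?_ h
    have := hn (orderOf g - 1)
    rwa [Nat.sub_add_cancel (orderOf_pos g), pow_orderOf_eq_one, one_smul] at this
  rcases h with h | h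
  · exact key g h
  · have h' : x ≤ g⁻¹ • x := by
      simpa using GPoset.smul_le_smul_of_le g⁻¹ h
    rw [← key g⁻¹ h', smul_inv_smul, key g⁻¹ h']

theorem length_add_le_of_strictMono {D : Type*} [Preorder D] {μ : D → ℕ} (hμ : StrictMono μ)
    {l : List D} (hl : l.Pairwise (· > ·)) {a b : ℕ} (hab : ∀ x ∈ l, a ≤ μ x ∧ μ x ≤ b) :
    l.length ≤ b + 1 - a := by
  have hnd : (l.map μ).Nodup := by
    rw [List.Nodup, List.pairwise_map]
    exact hl.imp fun h => (hμ h).ne'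
  have hsub : (l.map μ).toFinset ⊆ Finset.Icc a b := by
    intro t ht
    obtain ⟨x, hx, rfl⟩ := List.mem_map.1 (List.mem_toFinset.1 ht)
    exact Finset.mem_Icc.2 (hab x hx)
  have := Finset.card_le_card hsub
  rwa [List.toFinset_card_of_nodup hnd, List.length_map, Nat.card_Icc] at this

-- Labels are nonempty chains of `P`. They are moved freely, because `g • s = s` makes `x` and `g •
-- x` comparable; `k + 1` strictly nested ones need `k + 1` elements.
open scoped Pointwise in
theorem lt_card_of_mem_coindSet [Fintype G] (hG : (Fintype.card G).Prime) [Finite P]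
    (hP : IsFreeAction G P) {k : ℕ} (hk : k ∈ coindSet G (Realization (orderComplex P))) :
    k < Nat.card P := by
  obtain ⟨f, hf, hfe⟩ := hk
  obtain ⟨lab, h1, h2, δ, hδ, h3⟩ := exists_labelling_of_continuous hf hfe
  obtain ⟨l, hl, hs, hlS⟩ := ListChain.exists_strict_chain_of_labelling hG k (D := Set P)
    (fun g a b hab => Set.smul_set_mono hab) lab
    (fun g l => by
      ext u
      rw [Set.mem_smul_set_iff_inv_smul_mem]
      exact h1 g l u) h2
    (S := {s | s.Nonempty ∧ IsChain (· ≤ ·) s})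
    (by
      rintro g s ⟨hs, hc⟩
      refine ⟨hs.smul_set, ?_⟩
      rintro _ ⟨x, hx, rfl⟩ _ ⟨y, hy, rfl⟩ -
      exact (hc.total hx hy).imp (GPoset.smul_le_smul_of_le g) (GPoset.smul_le_smul_of_le g))
    (by
      rintro s ⟨⟨x, hx⟩, hc⟩ g hg
      have hgx : g • x ∈ s := by
        rw [← hg]
        exact Set.smul_mem_smul_set hx
      exact hP g x (smul_eq_self_of_comparable (hc.total hx hgx)))
    hδ
    (by
      intro l hl hfine
      obtain ⟨s, hs, e⟩ := h3 l hl hfine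
      rw [← e]
      exact ⟨hs.1, hs.2⟩)
  have := length_add_le_of_strictMono (μ := Set.ncard) (a := 1) (b := Nat.card P)
    (fun s t hst => Set.ncard_lt_ncard hst) hs fun s hs => by
      refine ⟨?_, Set.ncard_le_card s⟩
      exact (Set.ncard_pos (Set.toFinite s)).2 (hlS s hs).1
  omega

/-- Precompose with the inclusion of the first `k + 1` join factors. It allows both posets to be
tested at the smaller co-index. -/
theorem mem_coindSet_of_le [Finite G] {X : Type*} [TopologicalSpace X] [MulAction G X] {k n : ℕ}
    (hkn : k ≤ n) (hn : n ∈ coindSet G X) : k ∈ coindSet G X := by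
  classical
  have := Fintype.ofFinite G
  obtain ⟨f, hf, hfe⟩ := hn
  let φ : (Σ _ : Fin (k + 1), G) → (Σ _ : Fin (n + 1), G) :=
    fun v => ⟨Fin.castLE (by omega) v.1, v.2⟩
  have hφ : ∀ s ∈ (joinComplex G k).faces, s.image φ ∈ (joinComplex G n).faces := by
    rintro s ⟨hs, hs'⟩
    refine ⟨hs.image φ, ?_⟩
    intro a ha b hb hab
    obtain ⟨a, ha', rfl⟩ := Finset.mem_image.1 ha
    obtain ⟨b, hb', rfl⟩ := Finset.mem_image.1 hb
    rw [hs' a ha' b hb' (Fin.castLE_injective (by omega) hab)]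
  refine ⟨f ∘ Realization.map φ hφ, hf.comp (Realization.continuous_map φ hφ), fun g x => ?_⟩
  rw [Function.comp_apply, Realization.map_smul φ hφ (fun g v => rfl), hfe]
  rfl

theorem zero_mem_coindSet [Finite G] [Finite P] [Nonempty P] :
    0 ∈ coindSet G (Realization (orderComplex P)) := by
  classical
  have := Fintype.ofFinite G
  obtain ⟨x⟩ := ‹Nonempty P›
  let φ : (Σ _ : Fin (0 + 1), G) → P := fun v => v.2 • x
  have hφ : ∀ s ∈ (joinComplex G 0).faces, s.image φ ∈ (orderComplex P).faces := by
    rintro s ⟨hs, hs'⟩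
    refine ⟨hs.image φ, ?_⟩
    intro a ha b hb hab
    obtain ⟨a, ha', rfl⟩ := Finset.mem_image.1 ha
    obtain ⟨b, hb', rfl⟩ := Finset.mem_image.1 hb
    rw [hs' a ha' b hb' (Subsingleton.elim (α := Fin 1) _ _)] at hab
    exact (hab rfl).elim
  exact ⟨Realization.map φ hφ, Realization.continuous_map φ hφ,
    Realization.map_smul φ hφ fun g v => mul_smul g v.2 x⟩

theorem isGreatest_coind [Fintype G] (hG : (Fintype.card G).Prime) [Finite P] [Nonempty P]
    (hP : IsFreeAction G P) :
    IsGreatest (coindSet G (Realization (orderComplex P)))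
      (coind G (Realization (orderComplex P))) := by
  have hb : BddAbove (coindSet G (Realization (orderComplex P))) :=
    ⟨Nat.card P, fun k hk => (lt_card_of_mem_coindSet hG hP hk).le⟩
  exact ⟨Nat.sSup_mem ⟨0, zero_mem_coindSet⟩ hb, fun k hk => le_csSup hb hk⟩

end Coindex

/-! ### Colour classes and the counting bound -/

section Colouring

open scoped Pointwise

variable {G P Q : Type*} [Group G] [PartialOrder P] [PartialOrder Q] [GPoset G P] [GPoset G Q]

/-- Translating back the elements of a chain by distinct group elements gives an edge of the
compatibility hypergraph. -/
theorem image_mem_edgeSet_compatibilityHypergraph [Finite G] (hP : IsFreeAction G P) {s : Set P}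
    (hs : IsChain (· ≤ ·) s) {T : Set G} {x : G → P} (hx : ∀ g ∈ T, x g ∈ s) :
    (fun g => g⁻¹ • x g) '' T ∈ (compatibilityHypergraph G P T.ncard).edgeSet := by
  have hinj : Set.InjOn (fun g => g⁻¹ • x g) T := by
    intro g hg h hh e
    have e' : x h = (h * g⁻¹) • x g := by
      have e : g⁻¹ • x g = h⁻¹ • x h := e
      rw [mul_smul, e, smul_inv_smul]
    have hc := hs.total (hx g hg) (hx h hh)
    rw [e'] at hc
    exact (mul_inv_eq_one.1 (hP _ _ (smul_eq_self_of_comparable hc))).symm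
  refine ⟨Set.toFinite _, hinj.ncard_image, ?_⟩
  rintro _ ⟨g, hg, rfl⟩ _ ⟨h, hh, rfl⟩ hne
  refine ⟨g⁻¹ * h, fun e => hne ?_, ?_⟩
  · rw [inv_mul_eq_one.1 e]
  · simp only [mul_smul, smul_inv_smul]
    exact (hs.total (hx g hg) (hx h hh)).imp (GPoset.smul_le_smul_of_le g⁻¹)
      (GPoset.smul_le_smul_of_le g⁻¹)

/-- The group elements carrying the colour `i` on the product of `s` and `t`. -/
def colourClass (G : Type*) {P Q : Type*} [Group G] [MulAction G P] [MulAction G Q] {m : ℕ}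
    (c : P × Q → Fin m) (s : Set P) (t : Set Q) (i : Fin m) : Set G :=
  {g | ∃ x ∈ s, ∃ y ∈ t, c (g⁻¹ • x, g⁻¹ • y) = i}

theorem ncard_colourClass_lt [Finite G] (hP : IsFreeAction G P) (hQ : IsFreeAction G Q) {r m : ℕ}
    (hr : 0 < r) {c : P × Q → Fin m}
    (hc : ∀ e ∈ ((compatibilityHypergraph G P r).categoricalProduct
      (compatibilityHypergraph G Q r)).edgeSet, ∃ z ∈ e, ∃ w ∈ e, c z ≠ c w)
    {s : Set P} (hs : IsChain (· ≤ ·) s) {t : Set Q} (ht : IsChain (· ≤ ·) t) (i : Fin m) :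
    (colourClass G c s t i).ncard < r := by
  by_contra! h
  obtain ⟨T, hT, hTr⟩ := Set.exists_subset_card_eq h
  have hTne : T.Nonempty := (Set.ncard_pos (Set.toFinite T)).1 (by omega)
  have hex : ∀ g ∈ T, ∃ x ∈ s, ∃ y ∈ t, c (g⁻¹ • x, g⁻¹ • y) = i := fun g hg => hT hg
  obtain ⟨g₀, hg₀⟩ := hTne
  obtain ⟨x₀, -, y₀, -⟩ := hex g₀ hg₀
  have : Nonempty P := ⟨x₀⟩
  have : Nonempty Q := ⟨y₀⟩
  choose! x hx y hy hxy using hex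
  obtain ⟨z, hz, w, hw, hne⟩ := hc ((fun g => (g⁻¹ • x g, g⁻¹ • y g)) '' T) (by
    refine ⟨Set.Nonempty.image _ ⟨g₀, hg₀⟩, Set.toFinite _, ?_, ?_⟩
    · rw [Set.image_image, ← hTr]
      exact image_mem_edgeSet_compatibilityHypergraph hP hs hx
    · rw [Set.image_image, ← hTr]
      exact image_mem_edgeSet_compatibilityHypergraph hQ ht hy)
  obtain ⟨g, hg, rfl⟩ := hz
  obtain ⟨h, hh, rfl⟩ := hw
  exact hne ((hxy g hg).trans (hxy h hh).symm)

theorem card_le_sum_ncard_colourClass [Fintype G] {m : ℕ} (c : P × Q → Fin m) {s : Set P}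
    (hs : s.Nonempty) {t : Set Q} (ht : t.Nonempty) :
    Fintype.card G ≤ ∑ i, (colourClass G c s t i).ncard := by
  classical
  obtain ⟨x, hx⟩ := hs
  obtain ⟨y, hy⟩ := ht
  have hu : (Finset.univ : Finset G) ⊆
      Finset.univ.biUnion fun i => (colourClass G c s t i).toFinset := by
    intro g _
    simp only [Finset.mem_biUnion, Finset.mem_univ, true_and, Set.mem_toFinset]
    exact ⟨_, x, hx, y, hy, rfl⟩
  refine (Finset.card_le_card hu).trans (Finset.card_biUnion_le.trans (le_of_eq ?_))
  exact Finset.sum_congr rfl fun i _ => (Set.ncard_eq_toFinset_card' _).symm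

/-- Set families indexed by colours, with small members but many elements in total, are moved freely
by a group of prime order. -/
theorem eq_one_of_smul_eq_self [Fintype G] (hG : (Fintype.card G).Prime) {m : ℕ}
    {d : Fin m → Set G} (hd : ∀ i, (d i).ncard < Fintype.card G) (hpos : 0 < ∑ i, (d i).ncard)
    {g : G} (hg : g • d = d) : g = 1 := by
  have := Fact.mk hG
  by_contra hne
  have htop := zpowers_eq_top_of_prime_card (Nat.card_eq_fintype_card (α := G)) hne
  refine hpos.ne' (Finset.sum_eq_zero fun i _ => ?_)
  rw [Set.ncard_eq_zero]
  by_contra hemp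
  obtain ⟨a, ha⟩ := Set.nonempty_iff_ne_empty.2 hemp
  have hstab : ∀ h : G, h • d i = d i := by
    intro h
    have hle : Subgroup.zpowers g ≤ MulAction.stabilizer G (d i) := by
      rw [Subgroup.zpowers_le]
      exact congrFun hg i
    exact hle (htop ▸ Subgroup.mem_top h)
  -- A nonempty subset stable under all left translations is everything, against `hd`.
  have huniv : d i = Set.univ := by
    refine Set.eq_univ_of_forall fun b => ?_
    rw [← hstab (b * a⁻¹)]
    exact ⟨a, ha, by simp⟩
  have := hd i
  rw [huniv, Set.ncard_univ, Nat.card_eq_fintype_card] at this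
  exact lt_irrefl _ this

theorem add_card_le_of_colouring [Fintype G] (hG : (Fintype.card G).Prime) [Finite P] [Finite Q]
    (hP : IsFreeAction G P) (hQ : IsFreeAction G Q) {k : ℕ}
    (hkP : k ∈ coindSet G (Realization (orderComplex P)))
    (hkQ : k ∈ coindSet G (Realization (orderComplex Q))) {r m : ℕ} (hr : 0 < r)
    (hrG : r ≤ Fintype.card G) {c : P × Q → Fin m}
    (hc : ∀ e ∈ ((compatibilityHypergraph G P r).categoricalProduct
      (compatibilityHypergraph G Q r)).edgeSet, ∃ z ∈ e, ∃ w ∈ e, c z ≠ c w) :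
    k + Fintype.card G ≤ m * (r - 1) := by
  obtain ⟨f, hf, hfe⟩ := hkP
  obtain ⟨labP, hP1, hP2, δ, hδ, hP3⟩ := exists_labelling_of_continuous hf hfe
  obtain ⟨f', hf', hfe'⟩ := hkQ
  obtain ⟨labQ, hQ1, hQ2, δ', hδ', hQ3⟩ := exists_labelling_of_continuous hf' hfe'
  obtain ⟨l, hl, hs, hlS⟩ := ListChain.exists_strict_chain_of_labelling hG k (D := Fin m → Set G)
    (fun g a b hab i => by exact Set.smul_set_mono (hab i))
    (fun l => colourClass G c (labP l) (labQ l))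
    (fun g l => by
      funext i
      ext h
      rw [Pi.smul_apply, Set.mem_smul_set_iff_inv_smul_mem]
      constructor
      · rintro ⟨x, hx, y, hy, e⟩
        exact ⟨g⁻¹ • x, (hP1 g l x).1 hx, g⁻¹ • y, (hQ1 g l y).1 hy, by simpa [mul_smul] using e⟩
      · rintro ⟨x, hx, y, hy, e⟩
        exact ⟨g • x, (hP1 g l _).2 (by simpa using hx), g • y, (hQ1 g l _).2 (by simpa using hy),
          by simpa [mul_smul] using e⟩)
    (by
      rintro l n hnl i g ⟨x, hx, y, hy, e⟩
      exact ⟨x, hP2 l n hnl hx, y, hQ2 l n hnl hy, e⟩)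
    (S := {d | (∀ i, (d i).ncard < r) ∧ Fintype.card G ≤ ∑ i, (d i).ncard})
    (by
      rintro g d ⟨h1, h2⟩
      simpa only [Set.mem_ofPred_eq, Pi.smul_apply, Set.ncard_smul_set] using ⟨h1, h2⟩)
    (fun d hd g hg => eq_one_of_smul_eq_self hG (fun i => (hd.1 i).trans_le hrG)
      (hG.pos.trans_le hd.2) hg)
    (lt_min hδ hδ')
    (by
      intro l hl hfine
      obtain ⟨s, hs, es⟩ := hP3 l hl (hfine.mono (min_le_left _ _))
      obtain ⟨t, ht, et⟩ := hQ3 l hl (hfine.mono (min_le_right _ _))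
      rw [← es, ← et]
      exact ⟨fun i => ncard_colourClass_lt hP hQ hr hc hs.2 ht.2 i,
        card_le_sum_ncard_colourClass c hs.1 ht.1⟩)
  -- The total size takes `k + 1` distinct values between `|G|` and `m(r - 1)`.
  have := length_add_le_of_strictMono (μ := fun d : Fin m → Set G => ∑ i, (d i).ncard)
    (a := Fintype.card G) (b := m * (r - 1)) (fun d d' hdd => by
      obtain ⟨hle, i, hi⟩ := Pi.lt_def.1 hdd
      exact Finset.sum_lt_sum (fun i _ => Set.ncard_le_ncard (hle i))
        ⟨i, Finset.mem_univ i, Set.ncard_lt_ncard hi⟩) hs fun d hd => by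
      refine ⟨(hlS d hd).2, ?_⟩
      have : ∑ i, (d i).ncard ≤ ∑ _i : Fin m, (r - 1) :=
        Finset.sum_le_sum fun i _ => Nat.le_sub_one_of_lt ((hlS d hd).1 i)
      simpa using this
  omega

end Colouring

/-! ### Rounding and the main theorem -/

theorem ceil_add_ceil_sub_one_le {k n q m : ℕ} (hq : 0 < q) (h : k + n ≤ m * q) :
    ⌈((k : ℚ) + 1) / q⌉₊ + ⌈(n : ℚ) / q⌉₊ - 1 ≤ m := by
  have hq' : (0 : ℚ) < q := by exact_mod_cast hq
  have h1 := Nat.ceil_lt_add_one (a := ((k : ℚ) + 1) / q) (by positivity)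
  have h2 := Nat.ceil_lt_add_one (a := (n : ℚ) / q) (by positivity)
  set A := ⌈((k : ℚ) + 1) / q⌉₊
  set B := ⌈(n : ℚ) / q⌉₊
  rw [← sub_lt_iff_lt_add, lt_div_iff₀ hq'] at h1 h2
  by_contra! hlt
  have h3 : A * q < k + 1 + q := by
    have : (A : ℚ) * q < k + 1 + q := by linarith
    exact_mod_cast this
  have h4 : B * q < n + q := by
    have : (B : ℚ) * q < n + q := by linarith
    exact_mod_cast this
  -- Over the integers `h3` and `h4` give `(A + B)q ≤ k + n + 2q - 1 < (m + 2)q`; the `+ 1` in the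
  -- first numerator is absorbed by strictness.
  have h5 : (m + 2) * q ≤ (A + B) * q := Nat.mul_le_mul_right q (by omega)
  rw [add_mul, add_mul] at h5
  omega

theorem mainTheorem9 (p : ℕ) [Fact p.Prime]
    {P Q : Type*} [PartialOrder P] [PartialOrder Q] [Finite P] [Finite Q]
    [Nonempty P] [Nonempty Q]
    [GPoset (Multiplicative (ZMod p)) P] [GPoset (Multiplicative (ZMod p)) Q]
    (hP : IsFreeAction (Multiplicative (ZMod p)) P)
    (hQ : IsFreeAction (Multiplicative (ZMod p)) Q)
    (r : ℕ) (hr : 2 ≤ r) (hrp : r ≤ p) :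
    IsGreatest (coindSet (Multiplicative (ZMod p)) (Realization (orderComplex P)))
        (coind (Multiplicative (ZMod p)) (Realization (orderComplex P))) ∧
      IsGreatest (coindSet (Multiplicative (ZMod p)) (Realization (orderComplex Q)))
        (coind (Multiplicative (ZMod p)) (Realization (orderComplex Q))) ∧
      ((⌈((min (coind (Multiplicative (ZMod p)) (Realization (orderComplex P)))
              (coind (Multiplicative (ZMod p)) (Realization (orderComplex Q))) : ℕ) + 1 : ℚ)
            / ((r : ℚ) - 1)⌉₊
          + ⌈(p : ℚ) / ((r : ℚ) - 1)⌉₊ - 1 : ℕ) : ℕ∞)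
        ≤ ((compatibilityHypergraph (Multiplicative (ZMod p)) P r).categoricalProduct
            (compatibilityHypergraph (Multiplicative (ZMod p)) Q r)).chromaticNumber := by

  have hG : (Fintype.card (Multiplicative (ZMod p))).Prime := by
    simpa using Fact.out (p := p.Prime)
  have hP' := isGreatest_coind hG hP
  have hQ' := isGreatest_coind hG hQ
  refine ⟨hP', hQ', ?_⟩
  refine le_iInf₂ fun m hm => ?_
  obtain ⟨c, hc⟩ := hm
  have hmem : ∀ z : P × Q, z ∈ ((compatibilityHypergraph (Multiplicative (ZMod p)) P
      r).categoricalProduct (compatibilityHypergraph (Multiplicative (ZMod p)) Q r)).vertexSet :=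
    fun z => ⟨trivial, trivial⟩
  have h := add_card_le_of_colouring hG hP hQ
    (mem_coindSet_of_le (min_le_left _ _) hP'.1) (mem_coindSet_of_le (min_le_right _ _) hQ'.1)
    (r := r) (by omega) (by simpa using hrp) (c := fun z => c ⟨z, hmem z⟩) (fun e he => by
      obtain ⟨x, y, hx, hy, hxy⟩ := hc e he
      exact ⟨x, hx, y, hy, hxy⟩)
  have hcard : Fintype.card (Multiplicative (ZMod p)) = p := by simp
  rw [hcard] at h
  have := ceil_add_ceil_sub_one_le (q := r - 1) (by omega) h
  rw [Nat.cast_sub (by omega : 1 ≤ r), Nat.cast_one] at this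
  exact_mod_cast this
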